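/- Let $\mathbb{C}_+=\{z\in\mathbb{C}:\operatorname{Im} z>0\}$. A Herglotz function is an analytic map $M:\mathbb{C}_+\to\mathbb{C}_+$; a Herglotz representation of a function $M$ on $\mathbb{C}_+$ is a formula $$M(z)=Az+B+\int_{\mathbb{R}}\Big(\frac{1}{\lambda-z}-\frac{\lambda}{1+\lambda^2}\Big)\,d\mu(\lambda),\qquad z\in\mathbb{C}_+,$$ with $A\ge 0$, $B\in\mathbb{R}$ and $\mu$ a Borel measure on $\mathbb{R}$ with $\int_{\mathbb{R}}(1+\lambda^2)^{-1}d\mu(\lambda)<\infty$. Let $\alpha,\beta,\gamma\in\mathbb{R}$ with $\gamma\neq 0$, let $X=\begin{pmatrix}\beta&\alpha\\ \gamma&-\beta\end{pmatrix}$, write $e^{tX}=\begin{pmatrix}a_t&b_t\\ c_t&d_t\end{pmatrix}$ and $g_t(z)=\frac{a_tz+b_t}{c_tz+d_t}$ for $t\in\mathbb{R}$. Let $M_0$ be a Herglotz function and $M_t=g_t\circ M_0$. Put $$\mathcal{A}=\Big\{\lambda\in\mathbb{R}:\lim_{\varepsilon\downarrow0}M_0(\lambda+i\varepsilon)\text{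 exists in }\mathbb{C}_+\Big\},$$ $$\mathcal{P}=\Big\{\lambda\in\mathbb{R}:\lim_{\varepsilon\downarrow0}\varepsilon\operatorname{Im}M_0(\lambda+i\varepsilon)\in(0,\infty)\Big\}\cup\Big\{\lambda\in\mathbb{R}:\lim_{\varepsilon\downarrow0}\varepsilon^{-1}\operatorname{Im}M_0(\lambda+i\varepsilon)\in(0,\infty)\Big\},$$ and $\mathcal{S}=\mathbb{R}\setminus(\mathcal{A}\cup\mathcal{P})$. Write $|\cdot|$ for Lebesgue measure. (a) Every $M_t$ is a Herglotz function and has a unique Herglotz representation; let $\mu_t$ be its measure and $\mu_t=\mu_t^{ac}+\mu_t^{sc}+\mu_t^{pp}$ the Lebesgue decomposition of $\mu_t$ into its absolutely continuous, singularly continuous and pure point parts. The sets $\mathcal{A},\mathcal{S},\mathcal{P}$ are Borel. (b) For real $s_1<s_2$ and $z\in\mathbb{C}_+$ the function $t\mapsto M_t(z)$ is integrable on $[s_1,s_2]$, and $M_{s_1,s_2}(z)=\int_{s_1}^{s_2}M_t(z)\,dt$ has a unique Herglotz representation, without linear term; let $\mu_{s_1,s_2}$ be its measure. For $-\infty\le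 t_1<t_2\le\infty$ let $\mu_{t_1,t_2}$ be the supremum of the measures $\mu_{s_1,s_2}$ over all real $s_1<s_2$ with $t_1\le s_1$ and $s_2\le t_2$. For finite $t_1,t_2$ this agrees with the previous definition. In general $\mu_{t_1,t_2}(E)=\sup\mu_{s_1,s_2}(E)$ for every Borel set $E$, over the same $s_1,s_2$, and $$\int_{t_1}^{t_2}\operatorname{Im}M_t(z)\,dt=\int_{\mathbb{R}}\operatorname{Im}\frac{1}{\lambda-z}\,d\mu_{t_1,t_2}(\lambda),\qquad z\in\mathbb{C}_+,$$ where both sides may be $+\infty$. (c) Let $-\infty\le t_1<t_2\le\infty$. Then $\mu_{t_1,t_2}$ is absolutely continuous with respect to Lebesgue measure. The families $\mu_t,\mu_t^{ac},\mu_t^{sc},\mu_t^{pp}$ depend measurably on $t$, and the averaged measures $\int_{t_1}^{t_2}dt\,d\mu_t$, $\int_{t_1}^{t_2}dt\,d\mu_t^{ac}$, $\int_{t_1}^{t_2}dt\,d\mu_t^{sc}$, $\int_{t_1}^{t_2}dt\,d\mu_t^{pp}$ are absolutely continuous with respect to Lebesgue measure. For every bounded Borel set $\Delta\subset\mathbb{R}$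 the functions $t\mapsto\mu_t(\Delta),\ \mu_t^{ac}(\Delta),\ \mu_t^{sc}(\Delta),\ \mu_t^{pp}(\Delta)$ are measurable and, as equalities in $[0,\infty]$, $$\int_{t_1}^{t_2}\mu_t(\Delta)\,dt=\mu_{t_1,t_2}(\Delta),\qquad \int_{t_1}^{t_2}\mu_t^{ac}(\Delta)\,dt=\mu_{t_1,t_2}(\Delta\cap\mathcal{A}),$$ $$\int_{t_1}^{t_2}\mu_t^{sc}(\Delta)\,dt=\mu_{t_1,t_2}(\Delta\cap\mathcal{S}),\qquad \int_{t_1}^{t_2}\mu_t^{pp}(\Delta)\,dt=\mu_{t_1,t_2}(\Delta\cap\mathcal{P}).$$ (d) If $|\mathcal{S}|=0$, then $|\{t\in\mathbb{R}:\mu_t^{sc}(\mathbb{R})\neq0\}|=0$. If $|\mathcal{P}|=0$, then $|\{t\in\mathbb{R}:\mu_t^{pp}(\mathbb{R})\neq0\}|=0$. -/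

import Mathlib

open MeasureTheory Set Filter Topology

namespace SpecAvg

noncomputable section

/-- A Herglotz function: analytic on the open upper half-plane, which it maps into itself.
(Only the values of `M` on the open upper half-plane are ever used.) -/
def IsHerglotz (M : ℂ → ℂ) : Prop :=
  DifferentiableOn ℂ M {z | 0 < z.im} ∧ ∀ z : ℂ, 0 < z.im → 0 < (M z).im

/-- `M` has the Herglotz representation
`M z = A z + B + ∫ (1 / (x - z) - x / (1 + x ^ 2)) dμ(x)` on the open upper half-plane, where
`A ≥ 0`, `B` is real and `μ` is a Borel measure with `∫ dμ(x) / (1 + x ^ 2) < ∞`. -/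
def IsHerglotzRep (M : ℂ → ℂ) (A B : ℝ) (μ : Measure ℝ) : Prop :=
  0 ≤ A ∧ ∫⁻ x : ℝ, ENNReal.ofReal (1 / (1 + x ^ 2)) ∂μ < ⊤ ∧
    ∀ z : ℂ, 0 < z.im →
      M z = A * z + B + ∫ x : ℝ, (1 / ((x : ℂ) - z) - (x : ℂ) / (1 + (x : ℂ) ^ 2)) ∂μ

open Classical in
/-- The measure in the Herglotz representation of `M` (zero if there is no representation). -/
def herglotzMeasure (M : ℂ → ℂ) : Measure ℝ :=
  if h : ∃ μ : Measure ℝ, ∃ A B : ℝ, IsHerglotzRep M A B μ then h.choose else 0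

/-- The element `α X₁ + β X₂ + γ X₃` of the Lie algebra `sl₂(ℝ)`. -/
def sl2Elem (α β γ : ℝ) : Matrix (Fin 2) (Fin 2) ℝ := !![β, α; γ, -β]

/-- The linear fractional transformation with the coefficients of `g`. -/
def mobius (g : Matrix (Fin 2) (Fin 2) ℝ) (z : ℂ) : ℂ :=
  ((g 0 0 : ℂ) * z + (g 0 1 : ℂ)) / ((g 1 0 : ℂ) * z + (g 1 1 : ℂ))

/-- `M_t = g_t ∘ M₀`, where `g_t` is the linear fractional transformation of `exp (t X)`. -/
def flow (X : Matrix (Fin 2) (Fin 2) ℝ) (M₀ : ℂ → ℂ) (t : ℝ) (z : ℂ) : ℂ :=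
  mobius (NormedSpace.exp (t • X)) (M₀ z)

/-- The integrated function `M_{s₁,s₂}(z) = ∫_{s₁}^{s₂} M_t(z) dt`. -/
def intFlow (X : Matrix (Fin 2) (Fin 2) ℝ) (M₀ : ℂ → ℂ) (s₁ s₂ : ℝ) (z : ℂ) : ℂ :=
  ∫ t in s₁..s₂, flow X M₀ t z

/-- The averaged measure `μ_{t₁,t₂}`, with infinite end points allowed: the supremum, over all
finite `s₁ < s₂` with `t₁ ≤ s₁` and `s₂ ≤ t₂`, of the measures in the Herglotz representations
of the functions `M_{s₁,s₂}`. -/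
def avgMeasure (X : Matrix (Fin 2) (Fin 2) ℝ) (M₀ : ℂ → ℂ) (t₁ t₂ : EReal) : Measure ℝ :=
  ⨆ (s₁ : ℝ) (s₂ : ℝ) (_ : t₁ ≤ s₁ ∧ s₁ < s₂ ∧ (s₂ : EReal) ≤ t₂),
    herglotzMeasure (intFlow X M₀ s₁ s₂)

/-- The set of real points of the interval from `t₁` to `t₂`. -/
def timeInterval (t₁ t₂ : EReal) : Set ℝ := {t | t₁ < (t : EReal) ∧ (t : EReal) < t₂}

/-- The averaged measure `∫_{t₁}^{t₂} dt dκ_t` of a (measurable) family of measures. -/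
def timeIntegral (κ : ℝ → Measure ℝ) (t₁ t₂ : EReal) : Measure ℝ :=
  (volume.restrict (timeInterval t₁ t₂)).bind κ

/-- The absolutely continuous part. -/
def acPart (μ : Measure ℝ) : Measure ℝ := volume.withDensity (μ.rnDeriv volume)

/-- The pure point part: the restriction to the set of atoms. -/
def ppPart (μ : Measure ℝ) : Measure ℝ := μ.restrict {x | μ {x} ≠ 0}

/-- The singularly continuous part: the singular part off the set of atoms. -/
def scPart (μ : Measure ℝ) : Measure ℝ := (μ.singularPart volume).restrict {x | μ {x} = 0}

/-- The set `𝒜(M)`. -/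
def setA (M : ℂ → ℂ) : Set ℝ :=
  {x | ∃ w : ℂ, 0 < w.im ∧
    Tendsto (fun ε : ℝ => M (x + ε * Complex.I)) (𝓝[>] 0) (𝓝 w)}

/-- The set `𝒫(M)`. -/
def setP (M : ℂ → ℂ) : Set ℝ :=
  {x | ∃ m : ℝ, 0 < m ∧
      Tendsto (fun ε : ℝ => ε * (M (x + ε * Complex.I)).im) (𝓝[>] 0) (𝓝 m)} ∪
  {x | ∃ m : ℝ, 0 < m ∧
      Tendsto (fun ε : ℝ => ε⁻¹ * (M (x + ε * Complex.I)).im) (𝓝[>] 0) (𝓝 m)}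

/-- The set `𝒮(M)`. -/
def setS (M : ℂ → ℂ) : Set ℝ := (setA M ∪ setP M)ᶜ

end

end SpecAvg

open SpecAvg

namespace SpecAvg

noncomputable section

/-! Two facts carry the theorem: the sets `𝒜`, `𝒮`, `𝒫`, built from `M₀` alone, decompose every
`μ_t`, and averaging in `t` smooths.

Decomposition (`parts_flowMeasure`). A real Möbius map of determinant one preserves the existence of
a boundary value in the half-plane, so `𝒜` is the same set for all `M_t` (`setA_mobius`). By Fatou's
theorem (`IsHerglotzRep.ae_exists_tendsto`) the absolutely continuous part lives on `𝒜`; the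
singular part lives where the imaginary part blows up (`IsHerglotzRep.ae_singularPart_tendsto`),
hence off `𝒜`. Every atom of `μ_t` lies in `𝒫`, and at a point of `𝒫` that is not an atom `Im M_t`
tends to `0` (`IsHerglotzRep.atom_or_tendsto_zero`), so such points carry no mass. The three
Lebesgue parts of `μ_t` are therefore its restrictions to `𝒜`, `𝒮` and `𝒫`.

Smoothing (`integral_flow_im_le`). With `D_t = c_t w + d_t` one has `D_t' / D_t = γ g_t(w) - β`, so
`γ ∫ Im g_t(w) dt` is a change of argument. On a short time interval where `c_t ≠ 0` it is at most
`π` in absolute value, and the group law makes this uniform in the starting time and in `z`. Two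
consequences: the linear coefficient of `M_t` vanishes for almost every `t`, and the average of
`M_t` over a short interval has bounded imaginary part, which leaves no room for a singular part.
Hence a Lebesgue null set is `μ_t`-null for almost every `t` (`ae_flowMeasure_eq_zero`).

Fubini and uniqueness of the representation identify the measure of the averaged function with `∫
μ_t dt` (`avgMeasure_eq_timeIntegral`); the averaging formulas are this identity restricted to the
three sets. -/

/-! ### The Herglotz and Poisson kernels. -/

/-- The kernel of the Herglotz representation. -/
def herglotzKernel (z : ℂ) (x : ℝ) : ℂ := 1 / ((x : ℂ) - z) - (x : ℂ) / (1 + (x : ℂ) ^ 2)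

/-- The Poisson kernel of the upper half-plane, up to the factor `π`. -/
def poisson (l ε x : ℝ) : ℝ := ε / ((x - l) ^ 2 + ε ^ 2)

theorem ofReal_sub_ne_zero {z : ℂ} (hz : 0 < z.im) (x : ℝ) : (x : ℂ) - z ≠ 0 := by
  intro h
  have := congrArg Complex.im h
  simp at this
  linarith

theorem one_add_ofReal_sq_ne_zero (x : ℝ) : (1 : ℂ) + (x : ℂ) ^ 2 ≠ 0 := by
  have h : (0 : ℝ) < 1 + x ^ 2 := by positivity
  exact_mod_cast h.ne'

/-- This form exhibits the decay `1 / (1 + x²)`, with a numerator bounded in `x`. -/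
theorem herglotzKernel_eq {z : ℂ} (hz : 0 < z.im) (x : ℝ) :
    herglotzKernel z x = (z + (1 + z ^ 2) / ((x : ℂ) - z)) / (1 + (x : ℂ) ^ 2) := by
  have h1 := ofReal_sub_ne_zero hz x
  have h2 := one_add_ofReal_sq_ne_zero x
  unfold herglotzKernel
  field_simp
  ring

theorem im_le_norm_ofReal_sub {z : ℂ} (hz : 0 < z.im) (x : ℝ) : z.im ≤ ‖(x : ℂ) - z‖ := by
  have := Complex.abs_im_le_norm ((x : ℂ) - z)
  simp at this
  rwa [abs_of_pos hz] at this

theorem norm_one_add_ofReal_sq (x : ℝ) : ‖(1 : ℂ) + (x : ℂ) ^ 2‖ = 1 + x ^ 2 := by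
  have h : (0 : ℝ) ≤ 1 + x ^ 2 := by positivity
  rw [← Complex.norm_of_nonneg h]
  simp

theorem norm_herglotzKernel_le {z : ℂ} (hz : 0 < z.im) (x : ℝ) :
    ‖herglotzKernel z x‖ ≤ (‖z‖ + ‖1 + z ^ 2‖ / z.im) * (1 / (1 + x ^ 2)) := by
  rw [herglotzKernel_eq hz, norm_div, norm_one_add_ofReal_sq, mul_one_div]
  gcongr
  refine (norm_add_le _ _).trans ?_
  rw [norm_div]
  gcongr
  exact im_le_norm_ofReal_sub hz x

theorem measurable_herglotzKernel (z : ℂ) : Measurable (herglotzKernel z) := by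
  unfold herglotzKernel
  fun_prop

theorem poisson_nonneg {ε : ℝ} (hε : 0 ≤ ε) (l x : ℝ) : 0 ≤ poisson l ε x := by
  unfold poisson; positivity

theorem measurable_poisson : Measurable (fun p : ℝ × ℝ × ℝ => poisson p.1 p.2.1 p.2.2) := by
  unfold poisson; fun_prop

theorem im_one_div_ofReal_sub (z : ℂ) (x : ℝ) :
    (1 / ((x : ℂ) - z)).im = poisson z.re z.im x := by
  rw [one_div, Complex.inv_im, Complex.normSq_apply, poisson]
  simp
  ring

theorem herglotzKernel_im (z : ℂ) (x : ℝ) : (herglotzKernel z x).im = poisson z.re z.im x := by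
  have : ((x : ℂ) / (1 + (x : ℂ) ^ 2)).im = 0 := by
    have : (x : ℂ) / (1 + (x : ℂ) ^ 2) = ((x / (1 + x ^ 2) : ℝ) : ℂ) := by push_cast; rfl
    rw [this, Complex.ofReal_im]
  rw [herglotzKernel, Complex.sub_im, this, im_one_div_ofReal_sub, sub_zero]

/-- At `i` the kernel is purely imaginary and equals the integrability weight, so the value of `M`
there determines `B` and bounds the weighted mass. -/
theorem herglotzKernel_I (x : ℝ) :
    herglotzKernel Complex.I x = ((1 / (1 + x ^ 2) : ℝ) : ℂ) * Complex.I := by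
  rw [herglotzKernel_eq (by simp)]
  push_cast
  simp
  ring

/-! ### Reading off the data of a representation. -/

namespace IsHerglotzRep

variable {M : ℂ → ℂ} {A B : ℝ} {μ : Measure ℝ}

theorem integrable_weight (h : IsHerglotzRep M A B μ) :
    Integrable (fun x : ℝ => 1 / (1 + x ^ 2)) μ := by
  refine ⟨(by fun_prop : Measurable (fun x : ℝ => 1 / (1 + x ^ 2))).aestronglyMeasurable, ?_⟩
  rw [hasFiniteIntegral_iff_ofReal (Eventually.of_forall fun x => by positivity)]
  exact h.2.1

theorem integrable_kernel (h : IsHerglotzRep M A B μ) {z : ℂ} (hz : 0 < z.im) :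
    Integrable (herglotzKernel z) μ := by
  refine (h.integrable_weight.const_mul (‖z‖ + ‖1 + z ^ 2‖ / z.im)).mono'
    (measurable_herglotzKernel z).aestronglyMeasurable (Eventually.of_forall fun x => ?_)
  exact norm_herglotzKernel_le hz x

theorem eq_integral (h : IsHerglotzRep M A B μ) {z : ℂ} (hz : 0 < z.im) :
    M z = A * z + B + ∫ x, herglotzKernel z x ∂μ := h.2.2 z hz

theorem integrable_poisson (h : IsHerglotzRep M A B μ) {ε : ℝ} (hε : 0 < ε) (l : ℝ) :
    Integrable (poisson l ε) μ := by
  have := (h.integrable_kernel (z := ⟨l, ε⟩) hε).im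
  refine this.congr (Eventually.of_forall fun x => ?_)
  exact herglotzKernel_im _ x

theorem im_eq (h : IsHerglotzRep M A B μ) {z : ℂ} (hz : 0 < z.im) :
    (M z).im = A * z.im + ∫ x, poisson z.re z.im x ∂μ := by
  rw [h.eq_integral hz]
  have : (∫ x, herglotzKernel z x ∂μ).im = ∫ x, (herglotzKernel z x).im ∂μ :=
    (integral_im (h.integrable_kernel hz)).symm
  simp only [Complex.add_im, this, herglotzKernel_im]
  simp

theorem lintegral_poisson (h : IsHerglotzRep M A B μ) {z : ℂ} (hz : 0 < z.im) :
    ∫⁻ x, ENNReal.ofReal (poisson z.re z.im x) ∂μ = ENNReal.ofReal ((M z).im - A * z.im) := by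
  rw [h.im_eq hz, add_sub_cancel_left, ofReal_integral_eq_lintegral_ofReal
    (h.integrable_poisson hz _) (Eventually.of_forall fun x => poisson_nonneg hz.le _ _)]

theorem mul_im_le (h : IsHerglotzRep M A B μ) {z : ℂ} (hz : 0 < z.im) : A * z.im ≤ (M z).im := by
  rw [h.im_eq hz]
  have : 0 ≤ ∫ x, poisson z.re z.im x ∂μ := integral_nonneg fun x => poisson_nonneg hz.le _ _
  linarith

theorem ofReal_im (h : IsHerglotzRep M A B μ) {z : ℂ} (hz : 0 < z.im) :
    ENNReal.ofReal (M z).im =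
      ENNReal.ofReal (A * z.im) + ∫⁻ x, ENNReal.ofReal (poisson z.re z.im x) ∂μ := by
  rw [h.lintegral_poisson hz, ← ENNReal.ofReal_add (mul_nonneg h.1 hz.le)
    (sub_nonneg.2 (h.mul_im_le hz))]
  congr 1; ring

theorem eq_re (h : IsHerglotzRep M A B μ) : B = (M Complex.I).re := by
  rw [h.eq_integral (by simp)]
  simp only [herglotzKernel_I, integral_mul_const]
  rw [integral_complex_ofReal]
  simp

theorem im_I (h : IsHerglotzRep M A B μ) :
    (M Complex.I).im = A + ∫ x : ℝ, 1 / (1 + x ^ 2) ∂μ := by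
  rw [h.eq_integral (by simp)]
  simp only [herglotzKernel_I, integral_mul_const]
  rw [integral_complex_ofReal]
  simp

theorem lintegral_weight_le (h : IsHerglotzRep M A B μ) :
    ∫⁻ x : ℝ, ENNReal.ofReal (1 / (1 + x ^ 2)) ∂μ ≤ ENNReal.ofReal (M Complex.I).im := by
  rw [← ofReal_integral_eq_lintegral_ofReal h.integrable_weight
    (Eventually.of_forall fun x => by positivity)]
  apply ENNReal.ofReal_le_ofReal
  rw [h.im_I]
  linarith [h.1]

end IsHerglotzRep

/-- The weight is bounded below on bounded intervals, and Markov's inequality applies. -/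
theorem isLocallyFiniteMeasure_of_weight {μ : Measure ℝ}
    (h : ∫⁻ x : ℝ, ENNReal.ofReal (1 / (1 + x ^ 2)) ∂μ < ⊤) : IsLocallyFiniteMeasure μ := by
  refine ⟨fun x => ⟨Ioo (x - 1) (x + 1), Ioo_mem_nhds (by linarith) (by linarith), ?_⟩⟩
  have hm : Measurable (fun x : ℝ => ENNReal.ofReal (1 / (1 + x ^ 2))) := by fun_prop
  have hc : 0 < 1 / (1 + (|x| + 1) ^ 2) := by positivity
  refine (measure_mono (t := {y : ℝ | ENNReal.ofReal (1 / (1 + (|x| + 1) ^ 2)) ≤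
    ENNReal.ofReal (1 / (1 + y ^ 2))}) ?_).trans_lt ?_
  · intro y hy
    refine ENNReal.ofReal_le_ofReal ?_
    gcongr 1 / (1 + ?_)
    rw [← sq_abs y]
    gcongr
    have : |y - x| ≤ 1 := by rw [abs_le]; constructor <;> linarith [hy.1, hy.2]
    calc |y| = |x + (y - x)| := by congr 1; ring
      _ ≤ |x| + |y - x| := abs_add_le _ _
      _ ≤ _ := by linarith
  · exact meas_ge_le_lintegral_div hm.aemeasurable (by simpa using hc) ENNReal.ofReal_ne_top
      |>.trans_lt (ENNReal.div_lt_top h.ne (by simpa using hc))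

theorem IsHerglotzRep.isLocallyFiniteMeasure {M : ℂ → ℂ} {A B : ℝ} {μ : Measure ℝ}
    (h : IsHerglotzRep M A B μ) : IsLocallyFiniteMeasure μ :=
  isLocallyFiniteMeasure_of_weight h.2.1

namespace IsHerglotzRep

variable {M : ℂ → ℂ} {A B : ℝ} {μ : Measure ℝ}

/-- The point mass of the measure is the rescaled vertical boundary limit. -/
theorem tendsto_mul (h : IsHerglotzRep M A B μ) (l : ℝ) :
    Tendsto (fun ε : ℝ => (ε : ℂ) * M (l + ε * Complex.I)) (𝓝[>] 0)
      (𝓝 (Complex.I * (μ.real {l} : ℂ))) := by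
  have := h.isLocallyFiniteMeasure
  have hz : ∀ ε : ℝ, 0 < ε → 0 < ((l : ℂ) + ε * Complex.I).im := fun ε hε => by simpa using hε
  have hint : Tendsto (fun ε : ℝ => ∫ x, (ε : ℂ) * herglotzKernel (l + ε * Complex.I) x ∂μ)
      (𝓝[>] 0) (𝓝 (∫ x, ({l} : Set ℝ).indicator (fun _ => Complex.I) x ∂μ)) := by
    -- The factor `ε` cancels the `1 / ε` in the kernel bound, and `‖l + iε‖ ≤ |l| + 1` for `ε < 1`;
    -- this yields the constant.
    refine tendsto_integral_filter_of_dominated_convergence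
      (fun x => ((|l| + 1) + (1 + (|l| + 1) ^ 2)) * (1 / (1 + x ^ 2))) ?_ ?_ ?_ ?_
    · exact Eventually.of_forall fun ε =>
        ((measurable_herglotzKernel _).const_mul _).aestronglyMeasurable
    · filter_upwards [Ioo_mem_nhdsGT (show (0 : ℝ) < 1 by norm_num)] with ε hε
      refine Eventually.of_forall fun x => ?_
      have hn : ‖(l : ℂ) + ε * Complex.I‖ ≤ |l| + 1 := by
        refine (norm_add_le _ _).trans ?_
        simp only [Complex.norm_real, norm_mul, Complex.norm_I, mul_one, Real.norm_eq_abs]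
        rw [abs_of_pos hε.1]
        linarith [hε.2]
      have hk := norm_herglotzKernel_le (hz ε hε.1) x
      rw [norm_mul, Complex.norm_real, Real.norm_eq_abs, abs_of_pos hε.1]
      calc ε * ‖herglotzKernel (l + ε * Complex.I) x‖
          ≤ ε * ((‖(l : ℂ) + ε * Complex.I‖ + ‖1 + ((l : ℂ) + ε * Complex.I) ^ 2‖ / ε)
            * (1 / (1 + x ^ 2))) := by
            gcongr
            · exact hε.1.le
            · simpa using hk
        _ = (ε * ‖(l : ℂ) + ε * Complex.I‖ + ‖1 + ((l : ℂ) + ε * Complex.I) ^ 2‖)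
            * (1 / (1 + x ^ 2)) := by
            have := hε.1.ne'
            field_simp
        _ ≤ _ := by
            gcongr
            · calc ε * ‖(l : ℂ) + ε * Complex.I‖ ≤ 1 * (|l| + 1) := by
                    gcongr
                    exact hε.2.le
                _ = _ := one_mul _
            · refine (norm_add_le _ _).trans ?_
              rw [norm_one, norm_pow]
              gcongr
    · exact h.integrable_weight.const_mul _
    · refine Eventually.of_forall fun x => ?_
      rcases eq_or_ne x l with rfl | hx
      · rw [indicator_of_mem (mem_singleton x)]
        have : Tendsto (fun ε : ℝ => Complex.I - (ε : ℂ) * ((x : ℂ) / (1 + (x : ℂ) ^ 2)))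
            (𝓝[>] 0) (𝓝 (Complex.I - ((0 : ℝ) : ℂ) * ((x : ℂ) / (1 + (x : ℂ) ^ 2)))) := by
          refine Tendsto.mono_left (Continuous.tendsto ?_ 0) nhdsWithin_le_nhds
          fun_prop
        simp only [Complex.ofReal_zero, zero_mul, sub_zero] at this
        refine this.congr' ?_
        filter_upwards [self_mem_nhdsWithin] with ε hε
        have hε' : (ε : ℂ) ≠ 0 := by exact_mod_cast (ne_of_gt hε)
        have h2 := one_add_ofReal_sq_ne_zero x
        rw [herglotzKernel, mul_sub]
        congr 1
        rw [sub_add_cancel_left]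
        field_simp
        simp
      · rw [indicator_of_notMem (by simpa using hx)]
        have hxl : (x : ℂ) - ((l : ℂ) + ((0 : ℝ) : ℂ) * Complex.I) ≠ 0 := by
          simpa [sub_eq_zero] using hx
        have : Tendsto (fun ε : ℝ => (ε : ℂ) * herglotzKernel (l + ε * Complex.I) x) (𝓝[>] 0)
            (𝓝 (((0 : ℝ) : ℂ) * herglotzKernel (l + ((0 : ℝ) : ℂ) * Complex.I) x)) := by
          refine Tendsto.mono_left (ContinuousAt.tendsto (x := (0 : ℝ)) ?_) nhdsWithin_le_nhds
          unfold herglotzKernel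
          have : ContinuousAt (fun ε : ℝ => (x : ℂ) - ((l : ℂ) + (ε : ℂ) * Complex.I)) 0 := by
            fun_prop
          have h3 := (this.inv₀ hxl)
          simp only [one_div]
          fun_prop
        simpa using this
  have h1 : ∫ x, ({l} : Set ℝ).indicator (fun _ => Complex.I) x ∂μ
      = Complex.I * (μ.real {l} : ℂ) := by
    rw [integral_indicator_const _ (measurableSet_singleton l)]
    simp [mul_comm]
  rw [h1] at hint
  have h2 : Tendsto (fun ε : ℝ => (ε : ℂ) * (A * (l + ε * Complex.I) + B)) (𝓝[>] 0)
      (𝓝 (((0 : ℝ) : ℂ) * (A * (l + ((0 : ℝ) : ℂ) * Complex.I) + B))) := by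
    refine Tendsto.mono_left (Continuous.tendsto ?_ 0) nhdsWithin_le_nhds
    fun_prop
  have h3 := h2.add hint
  simp only [Complex.ofReal_zero, zero_mul, zero_add] at h3
  refine h3.congr' ?_
  filter_upwards [self_mem_nhdsWithin] with ε hε
  rw [h.eq_integral (hz ε hε), integral_const_mul]
  ring

theorem tendsto_mul_im (h : IsHerglotzRep M A B μ) (l : ℝ) :
    Tendsto (fun ε : ℝ => ε * (M (l + ε * Complex.I)).im) (𝓝[>] 0) (𝓝 (μ.real {l})) := by
  have := (Complex.continuous_im.tendsto _).comp (h.tendsto_mul l)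
  simpa [Function.comp_def, Complex.mul_im] using this

/-- The coefficient of the linear term is the growth rate along the imaginary axis. -/
theorem tendsto_im_div (h : IsHerglotzRep M A B μ) :
    Tendsto (fun n : ℕ => (M (((n : ℝ) + 1 : ℝ) * Complex.I)).im / (n + 1)) atTop (𝓝 A) := by
  have hint : Tendsto (fun n : ℕ => ∫ x, 1 / (x ^ 2 + ((n : ℝ) + 1) ^ 2) ∂μ) atTop
      (𝓝 (∫ _, (0 : ℝ) ∂μ)) := by
    refine tendsto_integral_of_dominated_convergence (fun x => 1 / (1 + x ^ 2)) ?_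
      h.integrable_weight ?_ ?_
    · exact fun n => (by fun_prop :
        Measurable fun x : ℝ => 1 / (x ^ 2 + ((n : ℝ) + 1) ^ 2)).aestronglyMeasurable
    · refine fun n => Eventually.of_forall fun x => ?_
      rw [Real.norm_of_nonneg (by positivity)]
      have : (0 : ℝ) ≤ n := n.cast_nonneg
      gcongr 1 / ?_
      nlinarith
    · refine Eventually.of_forall fun x => ?_
      simp only [one_div]
      refine tendsto_inv_atTop_zero.comp (tendsto_atTop_add_const_left _ _ ?_)
      exact (tendsto_pow_atTop (by norm_num)).comp
        (tendsto_atTop_add_const_right _ _ tendsto_natCast_atTop_atTop)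
  have h2 := hint.const_add A
  simp only [integral_zero, add_zero] at h2
  refine h2.congr fun n => ?_
  have hn : (0 : ℝ) < n + 1 := by positivity
  rw [h.im_eq (by simpa using hn)]
  simp only [Complex.mul_I_re, Complex.mul_I_im, Complex.ofReal_re, Complex.ofReal_im, neg_zero,
    poisson, sub_zero, div_eq_mul_inv ((n : ℝ) + 1), integral_const_mul]
  field_simp

end IsHerglotzRep

/-! ### Stieltjes inversion and uniqueness. -/

theorem continuous_poisson_left {ε : ℝ} (hε : 0 < ε) (x : ℝ) :
    Continuous fun l => poisson l ε x := by
  unfold poisson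
  refine Continuous.div₀ (by fun_prop) (by fun_prop) fun l => ?_
  positivity

theorem integral_poisson_left {ε : ℝ} (hε : 0 < ε) (x a b : ℝ) :
    ∫ l in a..b, poisson l ε x = Real.arctan ((b - x) / ε) - Real.arctan ((a - x) / ε) := by
  refine intervalIntegral.integral_eq_sub_of_hasDerivAt
    (f := fun l => Real.arctan ((l - x) / ε)) (fun l _ => ?_)
    ((continuous_poisson_left hε x).intervalIntegrable _ _)
  have := (((hasDerivAt_id l).sub_const x).div_const ε).arctan
  convert! this using 1
  unfold poisson
  simp only [id]
  field_simp
  ring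

theorem lintegral_poisson_Ioc {ε : ℝ} (hε : 0 < ε) (x : ℝ) {a b : ℝ} (hab : a ≤ b) :
    ∫⁻ l in Ioc a b, ENNReal.ofReal (poisson l ε x) =
      ENNReal.ofReal (Real.arctan ((b - x) / ε) - Real.arctan ((a - x) / ε)) := by
  rw [← integral_poisson_left hε, intervalIntegral.integral_of_le hab,
    ofReal_integral_eq_lintegral_ofReal (continuous_poisson_left hε x).integrableOn_Ioc
    (Eventually.of_forall fun l => poisson_nonneg hε.le _ _)]

/-- Follows from `1 + x² ≤ (1 + 2R²) + 2(x - l)²`, where the Poisson kernel times `(x - l)²` is at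
most `ε ≤ 1`. -/
theorem weight_mul_poisson_le {ε : ℝ} (hε : 0 < ε) (hε1 : ε ≤ 1) {R l : ℝ} (hl : |l| ≤ R) (x : ℝ) :
    poisson l ε x ≤ ((1 + 2 * R ^ 2) * poisson l ε x + 2) * (1 / (1 + x ^ 2)) := by
  have h0 : 0 < (x - l) ^ 2 + ε ^ 2 := by positivity
  have hl2 : l ^ 2 ≤ R ^ 2 := sq_le_sq' (by linarith [neg_abs_le l]) ((le_abs_self l).trans hl)
  rw [mul_one_div, le_div_iff₀ (by positivity), poisson]
  have h1 : ε / ((x - l) ^ 2 + ε ^ 2) * (x - l) ^ 2 ≤ 1 := by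
    rw [div_mul_eq_mul_div, div_le_one h0]
    nlinarith [sq_nonneg (x - l)]
  have h2 : 0 ≤ ε / ((x - l) ^ 2 + ε ^ 2) := by positivity
  have h3 : 1 + x ^ 2 ≤ (1 + 2 * R ^ 2) + 2 * (x - l) ^ 2 := by
    nlinarith [sq_nonneg (x - 2 * l)]
  nlinarith [mul_le_mul_of_nonneg_left h3 h2]

/-- Integrating the pointwise bound in `l` gives a dominating function independent of `ε`: the
arctangents differ by at most `π` and the interval has length at most `2R`. -/
theorem arctan_sub_le_weight {ε : ℝ} (hε : 0 < ε) (hε1 : ε ≤ 1) {R a b : ℝ} (hab : a ≤ b)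
    (ha : -R ≤ a) (hb : b ≤ R) (x : ℝ) :
    Real.arctan ((b - x) / ε) - Real.arctan ((a - x) / ε) ≤
      ((1 + 2 * R ^ 2) * Real.pi + 4 * R) * (1 / (1 + x ^ 2)) := by
  have hc := continuous_poisson_left hε x
  have h2 : ∫ l in a..b, poisson l ε x ≤
      ∫ l in a..b, ((1 + 2 * R ^ 2) * poisson l ε x + 2) * (1 / (1 + x ^ 2)) := by
    refine intervalIntegral.integral_mono_on hab (hc.intervalIntegrable _ _)
      (Continuous.intervalIntegrable (by fun_prop) _ _) fun l hl => ?_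
    exact weight_mul_poisson_le hε hε1 (abs_le.2 ⟨ha.trans hl.1, hl.2.trans hb⟩) x
  rw [intervalIntegral.integral_mul_const, intervalIntegral.integral_add
    (Continuous.intervalIntegrable (by fun_prop) _ _) (by simp),
    intervalIntegral.integral_const_mul, integral_poisson_left hε,
    intervalIntegral.integral_const, smul_eq_mul] at h2
  refine h2.trans ?_
  have h3 := Real.arctan_lt_pi_div_two ((b - x) / ε)
  have h4 := Real.neg_pi_div_two_lt_arctan ((a - x) / ε)
  refine mul_le_mul_of_nonneg_right (add_le_add (mul_le_mul_of_nonneg_left ?_ ?_) ?_) ?_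
  · linarith
  · positivity
  · linarith
  · positivity

/-- The added `n + 1` is of lower order when `c ≠ 0` and decides the tie at `c = 0`. -/
theorem tendsto_arctan_mul_add (c : ℝ) :
    Tendsto (fun n : ℕ => Real.arctan (((n : ℝ) + 1) ^ 2 * c + ((n : ℝ) + 1))) atTop
      (𝓝 (if 0 ≤ c then Real.pi / 2 else -(Real.pi / 2))) := by
  have hn : Tendsto (fun n : ℕ => (n : ℝ) + 1) atTop atTop :=
    tendsto_atTop_add_const_right _ _ tendsto_natCast_atTop_atTop
  split_ifs with hc
  · refine (Real.tendsto_arctan_atTop.mono_right nhdsWithin_le_nhds).comp ?_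
    refine tendsto_atTop_mono (fun n => ?_) hn
    nlinarith [sq_nonneg ((n : ℝ) + 1), mul_nonneg (sq_nonneg ((n : ℝ) + 1)) hc]
  · refine (Real.tendsto_arctan_atBot.mono_right nhdsWithin_le_nhds).comp ?_
    have h1 : Tendsto (fun n : ℕ => ((n : ℝ) + 1) * c + 1) atTop atBot :=
      tendsto_atBot_add_const_right _ _ (hn.atTop_mul_const_of_neg (not_le.1 hc))
    refine (hn.atTop_mul_atBot₀ h1).congr fun n => ?_
    ring

/-- The window is shifted by `1 / (n + 1)`, much more than the height `1 / (n + 1)²`. So the limit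
is an exact half-open indicator, instead of giving end-point atoms half their weight. -/
theorem tendsto_arctan_sub {a b : ℝ} (hab : a ≤ b) (x : ℝ) :
    Tendsto (fun n : ℕ => ENNReal.ofReal
      (Real.arctan ((b + 1 / ((n : ℝ) + 1) - x) / (1 / ((n : ℝ) + 1) ^ 2)) -
        Real.arctan ((a + 1 / ((n : ℝ) + 1) - x) / (1 / ((n : ℝ) + 1) ^ 2)))) atTop
      (𝓝 ((Ioc a b).indicator (fun _ => ENNReal.ofReal Real.pi) x)) := by
  have key : ∀ (c : ℝ) (n : ℕ), (c + 1 / ((n : ℝ) + 1) - x) / (1 / ((n : ℝ) + 1) ^ 2) =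
      ((n : ℝ) + 1) ^ 2 * (c - x) + ((n : ℝ) + 1) := by
    intro c n
    have : (n : ℝ) + 1 ≠ 0 := by positivity
    field_simp
    ring
  simp only [key]
  have h := ENNReal.tendsto_ofReal ((tendsto_arctan_mul_add (b - x)).sub
    (tendsto_arctan_mul_add (a - x)))
  convert! h using 2
  simp only [indicator, mem_Ioc, sub_nonneg]
  by_cases h1 : x ≤ a
  · simp [h1, h1.trans hab, not_lt.2 h1]
  · by_cases h2 : x ≤ b
    · simp [h1, h2, not_le.1 h1]
    · simp [h1, h2]

/-- Stieltjes inversion. -/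
theorem IsHerglotzRep.tendsto_lintegral_im {M : ℂ → ℂ} {A B : ℝ} {μ : Measure ℝ}
    (h : IsHerglotzRep M A B μ) {a b : ℝ} (hab : a ≤ b) :
    Tendsto (fun n : ℕ => ∫⁻ l in Ioc (a + 1 / ((n : ℝ) + 1)) (b + 1 / ((n : ℝ) + 1)),
      ENNReal.ofReal (M (l + (1 / ((n : ℝ) + 1) ^ 2 : ℝ) * Complex.I)).im) atTop
      (𝓝 (ENNReal.ofReal Real.pi * μ (Ioc a b))) := by
  have := h.isLocallyFiniteMeasure
  have hε : ∀ n : ℕ, 0 < 1 / ((n : ℝ) + 1) ^ 2 := fun n => by positivity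
  have hε1 : ∀ n : ℕ, 1 / ((n : ℝ) + 1) ^ 2 ≤ 1 := fun n => by
    rw [div_le_one (by positivity)]
    have : (0 : ℝ) ≤ n := n.cast_nonneg
    nlinarith
  have hn1 : ∀ n : ℕ, 0 < 1 / ((n : ℝ) + 1) ∧ 1 / ((n : ℝ) + 1) ≤ 1 := fun n => by
    refine ⟨by positivity, ?_⟩
    rw [div_le_one (by positivity)]
    have : (0 : ℝ) ≤ n := n.cast_nonneg
    linarith
  -- By Tonelli, the Poisson kernel is integrated in `l` first, which produces the arctangents.
  have heq : ∀ n : ℕ, ∫⁻ l in Ioc (a + 1 / ((n : ℝ) + 1)) (b + 1 / ((n : ℝ) + 1)),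
      ENNReal.ofReal (M (l + (1 / ((n : ℝ) + 1) ^ 2 : ℝ) * Complex.I)).im =
      ENNReal.ofReal (A * (1 / ((n : ℝ) + 1) ^ 2)) * ENNReal.ofReal (b - a) +
      ∫⁻ x, ENNReal.ofReal
      (Real.arctan ((b + 1 / ((n : ℝ) + 1) - x) / (1 / ((n : ℝ) + 1) ^ 2)) -
        Real.arctan ((a + 1 / ((n : ℝ) + 1) - x) / (1 / ((n : ℝ) + 1) ^ 2))) ∂μ := by
    intro n
    have h1 : ∀ l : ℝ, ENNReal.ofReal (M (l + (1 / ((n : ℝ) + 1) ^ 2 : ℝ) * Complex.I)).im =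
        ENNReal.ofReal (A * (1 / ((n : ℝ) + 1) ^ 2)) +
          ∫⁻ x, ENNReal.ofReal (poisson l (1 / ((n : ℝ) + 1) ^ 2) x) ∂μ := by
      intro l
      have hz : 0 < ((l : ℂ) + (1 / ((n : ℝ) + 1) ^ 2 : ℝ) * Complex.I).im := by
        rw [Complex.add_im, Complex.ofReal_im, Complex.im_ofReal_mul, Complex.I_im]
        simpa using hε n
      rw [h.ofReal_im hz]
      simp only [Complex.add_im, Complex.ofReal_im, Complex.im_ofReal_mul, Complex.I_im,
        Complex.add_re, Complex.ofReal_re, Complex.re_ofReal_mul, Complex.I_re, mul_zero,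
        add_zero, zero_add, mul_one]
    simp only [h1]
    rw [lintegral_add_left measurable_const, lintegral_const, Measure.restrict_apply_univ,
      Real.volume_Ioc, lintegral_lintegral_swap]
    · congr 2
      · congr 1; ring
      · funext x
        exact lintegral_poisson_Ioc (hε n) x (by linarith)
    · refine Measurable.aemeasurable ?_
      exact (measurable_poisson.comp (by fun_prop :
        Measurable fun p : ℝ × ℝ => (p.1, (1 / ((n : ℝ) + 1) ^ 2), p.2))).ennreal_ofReal
  simp only [heq]
  have hA : Tendsto (fun n : ℕ => ENNReal.ofReal (A * (1 / ((n : ℝ) + 1) ^ 2)) *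
      ENNReal.ofReal (b - a)) atTop (𝓝 (ENNReal.ofReal (A * 0) * ENNReal.ofReal (b - a))) := by
    refine ENNReal.Tendsto.mul_const (ENNReal.tendsto_ofReal ?_) (Or.inr ENNReal.ofReal_ne_top)
    refine Tendsto.const_mul _ ?_
    simp only [one_div]
    exact tendsto_inv_atTop_zero.comp ((tendsto_pow_atTop (by norm_num)).comp
        (tendsto_atTop_add_const_right _ _ tendsto_natCast_atTop_atTop))
  set R : ℝ := |a| + |b| + 1 with hR
  have hI : Tendsto (fun n : ℕ => ∫⁻ x, ENNReal.ofReal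
      (Real.arctan ((b + 1 / ((n : ℝ) + 1) - x) / (1 / ((n : ℝ) + 1) ^ 2)) -
        Real.arctan ((a + 1 / ((n : ℝ) + 1) - x) / (1 / ((n : ℝ) + 1) ^ 2))) ∂μ) atTop
      (𝓝 (∫⁻ x, (Ioc a b).indicator (fun _ => ENNReal.ofReal Real.pi) x ∂μ)) := by
    refine tendsto_lintegral_of_dominated_convergence
      (fun x => ENNReal.ofReal (((1 + 2 * R ^ 2) * Real.pi + 4 * R) * (1 / (1 + x ^ 2))))
      (fun n => by fun_prop) (fun n => Eventually.of_forall fun x => ?_) ?_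
      (Eventually.of_forall fun x => tendsto_arctan_sub hab x)
    · refine ENNReal.ofReal_le_ofReal (arctan_sub_le_weight (hε n) (hε1 n) (by linarith) ?_ ?_ x)
      · linarith [neg_abs_le a, abs_nonneg b, (hn1 n).1]
      · linarith [le_abs_self b, abs_nonneg a, (hn1 n).2]
    · exact ((h.integrable_weight.const_mul _).lintegral_lt_top).ne
  have := hA.add hI
  rw [lintegral_indicator_const measurableSet_Ioc] at this
  simpa using this

/-- The Herglotz representation is unique. -/
theorem IsHerglotzRep.unique {M : ℂ → ℂ} {A B A' B' : ℝ} {μ μ' : Measure ℝ}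
    (h : IsHerglotzRep M A B μ) (h' : IsHerglotzRep M A' B' μ') : A = A' ∧ B = B' ∧ μ = μ' := by
  refine ⟨tendsto_nhds_unique h.tendsto_im_div h'.tendsto_im_div, h.eq_re.trans h'.eq_re.symm, ?_⟩
  have := h.isLocallyFiniteMeasure
  refine Measure.ext_of_Ioc _ _ fun a b hab => ?_
  have := tendsto_nhds_unique (h.tendsto_lintegral_im hab.le) (h'.tendsto_lintegral_im hab.le)
  rwa [ENNReal.mul_right_inj (by simpa using Real.pi_pos) ENNReal.ofReal_ne_top] at this

theorem IsHerglotzRep.herglotzMeasure_eq {M : ℂ → ℂ} {A B : ℝ} {μ : Measure ℝ}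
    (h : IsHerglotzRep M A B μ) : herglotzMeasure M = μ := by
  have hex : ∃ μ : Measure ℝ, ∃ A B : ℝ, IsHerglotzRep M A B μ := ⟨μ, A, B, h⟩
  rw [herglotzMeasure, dif_pos hex]
  obtain ⟨A', B', h'⟩ := hex.choose_spec
  exact (h'.unique h).2.2

theorem IsHerglotzRep.existsUnique {M : ℂ → ℂ} {A B : ℝ} {μ : Measure ℝ}
    (h : IsHerglotzRep M A B μ) :
    ∃! p : ℝ × ℝ × Measure ℝ, IsHerglotzRep M p.1 p.2.1 p.2.2 := by
  refine ⟨(A, B, μ), h, fun p hp => ?_⟩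
  obtain ⟨h1, h2, h3⟩ := hp.unique h
  exact Prod.ext h1 (Prod.ext h2 h3)

/-! ### Existence of the representation: the disc, then the Cayley transform. -/

/-- The Schwarz integral formula on the unit disc. -/
theorem circleAverage_schwarz {g : ℂ → ℂ} (hg : DifferentiableOn ℂ g (Metric.closedBall 0 1))
    {w : ℂ} (hw : ‖w‖ < 1) :
    Real.circleAverage (fun e => (e + w) / (e - w) * ((g e).re : ℂ)) 0 1 =
      g w - (g 0).im * Complex.I := by
  have hcl : closure (Metric.ball (0 : ℂ) |1|) = Metric.closedBall 0 1 := by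
    rw [abs_one, closure_ball _ one_ne_zero]
  have hgc : DiffContOnCl ℂ g (Metric.ball 0 |1|) :=
    DifferentiableOn.diffContOnCl (hcl ▸ hg)
  have hw' : w ∈ Metric.ball (0 : ℂ) |1| := by simpa using hw
  have hne : ∀ e : ℂ, ‖e‖ = 1 → e - w ≠ 0 := by
    intro e he h
    rw [sub_eq_zero] at h
    rw [h] at he
    linarith
  have hne' : ∀ e : ℂ, ‖e‖ ≤ 1 → 1 - (starRingEnd ℂ) w * e ≠ 0 := by
    intro e he h
    have h1 : ‖(starRingEnd ℂ) w * e‖ = 1 := by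
      rw [← sub_eq_zero.1 h, norm_one]
    rw [norm_mul, Complex.norm_conj] at h1
    nlinarith [norm_nonneg w, norm_nonneg e]
  have hgs : ContinuousOn g (Metric.sphere 0 1) :=
    hg.continuousOn.mono Metric.sphere_subset_closedBall
  have A1 : Real.circleAverage (fun e => (e / (e - w)) * g e) 0 1 = g w := by
    simpa using hgc.circleAverage_smul_div hw'
  have A2 : Real.circleAverage g 0 1 = g 0 := hgc.circleAverage
  have hK : DifferentiableOn ℂ
      (fun e => (1 + (starRingEnd ℂ) w * e) / (1 - (starRingEnd ℂ) w * e) * g e)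
      (Metric.closedBall 0 1) := by
    refine DifferentiableOn.mul (DifferentiableOn.div (by fun_prop) (by fun_prop) ?_) hg
    intro e he
    exact hne' e (by simpa using he)
  have A3 : Real.circleAverage
      (fun e => (1 + (starRingEnd ℂ) w * e) / (1 - (starRingEnd ℂ) w * e) * g e) 0 1 = g 0 := by
    have := (DifferentiableOn.diffContOnCl (hcl ▸ hK)).circleAverage
    simpa using this
  have I1 : CircleIntegrable (fun e => (e / (e - w)) * g e) 0 1 := by
    refine ContinuousOn.circleIntegrable zero_le_one ?_
    refine ContinuousOn.mul (ContinuousOn.div (by fun_prop) (by fun_prop) ?_) hgs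
    intro e he
    exact hne e (by simpa using he)
  have I2 : CircleIntegrable g 0 1 := hgs.circleIntegrable zero_le_one
  have I3 : CircleIntegrable
      (fun e => (1 + (starRingEnd ℂ) w * e) / (1 - (starRingEnd ℂ) w * e) * g e) 0 1 :=
    (hK.continuousOn.mono Metric.sphere_subset_closedBall).circleIntegrable zero_le_one
  have A4 : Real.circleAverage (fun e => (starRingEnd ℂ)
      ((1 + (starRingEnd ℂ) w * e) / (1 - (starRingEnd ℂ) w * e) * g e)) 0 1 =
      (starRingEnd ℂ) (g 0) := by
    rw [← A3]
    exact Complex.conjCLE.toContinuousLinearMap.circleAverage_comp_comm I3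
  -- On the circle `(e + w) / (e - w)` is both `2e / (e - w) - 1` and the conjugate of `(1 + w̄e) /
  -- (1 - w̄e)`. Using the first form on `g` and the second on its conjugate in `Re g = (g + ḡ) / 2`
  -- splits the integrand into terms averaging to `g w`, `-g 0 / 2` and `conj (g 0) / 2`.
  have hpt : Real.circleAverage (fun e => (e + w) / (e - w) * ((g e).re : ℂ)) 0 1 =
      Real.circleAverage (((fun e => (e / (e - w)) * g e) + (-(1 / 2 : ℝ)) • g) + (1 / 2 : ℝ) •
        (fun e => (starRingEnd ℂ)
      ((1 + (starRingEnd ℂ) w * e) / (1 - (starRingEnd ℂ) w * e) * g e))) 0 1 := by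
    refine Real.circleAverage_congr_sphere fun e he => ?_
    have he1 : ‖e‖ = 1 := by simpa using he
    have hee : e * (starRingEnd ℂ) e = 1 := by
      rw [Complex.mul_conj, Complex.normSq_eq_norm_sq, he1]; simp
    have hc : (starRingEnd ℂ) ((1 + (starRingEnd ℂ) w * e) / (1 - (starRingEnd ℂ) w * e)) =
        (e + w) / (e - w) := by
      have h1 := hne e he1
      have h2 : (1 : ℂ) - w * (starRingEnd ℂ) e ≠ 0 := by
        intro h
        apply h1
        calc e - w = e * (1 - w * (starRingEnd ℂ) e) - w * (1 - e * (starRingEnd ℂ) e) := by ring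
          _ = 0 := by rw [h, hee]; ring
      simp only [map_div₀, map_add, map_sub, map_one, map_mul, Complex.conj_conj]
      rw [div_eq_div_iff h2 h1]
      linear_combination (2 * w) * hee
    simp only [Pi.add_apply, Pi.smul_apply, map_mul, hc]
    rw [Complex.re_eq_add_conj]
    have h1 := hne e he1
    simp only [Complex.real_smul]
    push_cast
    field_simp
    ring
  have I2' : CircleIntegrable ((-(1 / 2 : ℝ)) • g) 0 1 :=
    (hgs.const_smul _).circleIntegrable zero_le_one
  have I4' : CircleIntegrable ((1 / 2 : ℝ) • (fun e => (starRingEnd ℂ)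
      ((1 + (starRingEnd ℂ) w * e) / (1 - (starRingEnd ℂ) w * e) * g e))) 0 1 :=
    ((Complex.continuous_conj.comp_continuousOn (hK.continuousOn.mono
      Metric.sphere_subset_closedBall)).const_smul _).circleIntegrable zero_le_one
  rw [hpt, Real.circleAverage_add (I1.add I2') I4', Real.circleAverage_add I1 I2',
    Real.circleAverage_smul, Real.circleAverage_smul, A1, A2, A4]
  apply Complex.ext <;> simp <;> ring

/-- The point of the unit circle with a given angle. -/
def unitCirclePoint (θ : ℝ) : Metric.sphere (0 : ℂ) 1 := ⟨circleMap 0 1 θ, by simp⟩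

theorem continuous_unitCirclePoint : Continuous unitCirclePoint :=
  (continuous_circleMap 0 1).subtype_mk _

/-- A nonnegative density on the unit circle defines a finite measure that computes
circle averages. -/
theorem exists_finiteMeasure_circleAverage {u : ℂ → ℝ} (hu : ContinuousOn u (Metric.sphere 0 1))
    (hu0 : ∀ e ∈ Metric.sphere (0 : ℂ) 1, 0 ≤ u e) :
    ∃ σ : FiniteMeasure (Metric.sphere (0 : ℂ) 1), ∀ φ : ℂ → ℂ,
      ContinuousOn φ (Metric.sphere 0 1) →
      ∫ e, φ e ∂(σ : Measure (Metric.sphere (0 : ℂ) 1)) =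
        Real.circleAverage (fun e => φ e * (u e : ℂ)) 0 1 := by
  have huc : Continuous fun θ => u (circleMap 0 1 θ) :=
    hu.comp_continuous (continuous_circleMap 0 1) (fun θ => by simp)
  have hun : ∀ θ, 0 ≤ u (circleMap 0 1 θ) := fun θ => hu0 _ (by simp)
  have hf : Measurable fun θ : ℝ => ENNReal.ofReal ((2 * Real.pi)⁻¹ * u (circleMap 0 1 θ)) :=
    (huc.measurable.const_mul _).ennreal_ofReal
  set ρ : Measure ℝ := (volume.restrict (Ioc 0 (2 * Real.pi))).withDensity
    fun θ => ENNReal.ofReal ((2 * Real.pi)⁻¹ * u (circleMap 0 1 θ)) with hρ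
  have hfin : IsFiniteMeasure ρ := by
    refine isFiniteMeasure_withDensity_ofReal ?_
    exact (continuous_const.mul huc).integrableOn_Ioc.2
  refine ⟨⟨ρ.map unitCirclePoint, inferInstance⟩, fun φ hφ => ?_⟩
  have hφc : Continuous fun e : Metric.sphere (0 : ℂ) 1 => φ e := hφ.domRestrict
  rw [FiniteMeasure.toMeasure_mk, integral_map continuous_unitCirclePoint.measurable.aemeasurable
    hφc.aestronglyMeasurable, hρ, integral_withDensity_eq_integral_toReal_smul hf
    (Eventually.of_forall fun _ => ENNReal.ofReal_lt_top), Real.circleAverage_def,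
    intervalIntegral.integral_of_le (by positivity), ← integral_smul]
  refine integral_congr_ae (Eventually.of_forall fun θ => ?_)
  simp only [unitCirclePoint]
  rw [ENNReal.toReal_ofReal (mul_nonneg (by positivity) (hun θ))]
  simp only [Complex.real_smul]
  push_cast
  ring

/-- The Herglotz representation theorem on the unit disc. -/
theorem exists_measure_disc {f : ℂ → ℂ} (hf : DifferentiableOn ℂ f (Metric.ball 0 1))
    (hpos : ∀ w, ‖w‖ < 1 → 0 ≤ (f w).re) :
    ∃ σ : FiniteMeasure (Metric.sphere (0 : ℂ) 1), ∀ w : ℂ, ‖w‖ < 1 →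
      f w = (f 0).im * Complex.I +
        ∫ e, ((e : ℂ) + w) / ((e : ℂ) - w) ∂(σ : Measure (Metric.sphere (0 : ℂ) 1)) := by
  set r : ℕ → ℝ := fun n => 1 - 1 / ((n : ℝ) + 1) with hr
  have hr0 : ∀ n, 0 ≤ r n := fun n => by
    rw [hr, sub_nonneg, div_le_one (by positivity)]
    linarith [(n.cast_nonneg : (0 : ℝ) ≤ n)]
  have hr1 : ∀ n, r n < 1 := fun n => by
    have : 0 < 1 / ((n : ℝ) + 1) := by positivity
    simp only [hr]; linarith
  have hrt : Tendsto r atTop (𝓝 1) := by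
    have := (tendsto_one_div_add_atTop_nhds_zero_nat (𝕜 := ℝ)).const_sub 1
    simpa only [sub_zero] using this
  have hmem : ∀ n (w : ℂ), ‖w‖ ≤ 1 → ‖(r n : ℂ) * w‖ < 1 := fun n w hw => by
    rw [norm_mul, Complex.norm_of_nonneg (hr0 n)]
    nlinarith [hr0 n, hr1 n, norm_nonneg w]
  have hg : ∀ n, DifferentiableOn ℂ (fun w => f ((r n : ℂ) * w)) (Metric.closedBall 0 1) := by
    intro n
    refine hf.comp (by fun_prop) fun w hw => ?_
    simpa using hmem n w (by simpa using hw)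
  have hs : ∀ n, ∃ σ : FiniteMeasure (Metric.sphere (0 : ℂ) 1), ∀ w : ℂ, ‖w‖ < 1 →
      ∫ e, ((e : ℂ) + w) / ((e : ℂ) - w) ∂(σ : Measure (Metric.sphere (0 : ℂ) 1)) =
        f ((r n : ℂ) * w) - (f 0).im * Complex.I := by
    intro n
    obtain ⟨σ, hσ⟩ := exists_finiteMeasure_circleAverage (u := fun e => (f ((r n : ℂ) * e)).re)
      (Complex.continuous_re.comp_continuousOn
        ((hg n).continuousOn.mono Metric.sphere_subset_closedBall))
      (fun e he => hpos _ (hmem n e (by simpa using (mem_sphere_zero_iff_norm.1 he).le)))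
    refine ⟨σ, fun w hw => ?_⟩
    rw [hσ (fun e => (e + w) / (e - w)), circleAverage_schwarz (hg n) hw]
    · simp
    · refine ContinuousOn.div (by fun_prop) (by fun_prop) fun e he h => ?_
      rw [sub_eq_zero] at h
      rw [mem_sphere_zero_iff_norm, h] at he
      linarith
  choose s hs using hs
  -- At `w = 0` the kernel is `1`, so every mass equals `Re f 0` and the sequence stays in a compact
  -- set of measures.
  have hmass : ∀ n, (s n).mass ≤ (f 0).re.toNNReal := by
    intro n
    have h0 := hs n 0 (by simp)
    have h1 : ∀ e : Metric.sphere (0 : ℂ) 1, ((e : ℂ) + 0) / ((e : ℂ) - 0) = 1 := by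
      intro e
      have : (e : ℂ) ≠ 0 := ne_zero_of_mem_unit_sphere e
      simp [this]
    simp only [h1, mul_zero] at h0
    have h2 := congrArg Complex.re h0
    simp at h2
    rw [← NNReal.coe_le_coe, Real.coe_toNNReal _ (hpos 0 (by simp)), ← h2]
  have hK := isCompact_setOfPred_finiteMeasure_le_of_compactSpace (Metric.sphere (0 : ℂ) 1)
    (f 0).re.toNNReal
  -- A limit along a free ultrafilter takes the place of a convergent subsequence.
  obtain ⟨σ, -, hσ⟩ := hK.ultrafilter_le_nhds ((hyperfilter ℕ).map s)
    (by rw [le_principal_iff]; exact Filter.mem_map.2 (Filter.mem_of_superset univ_mem fun n _ => hmass n))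
  have hσt : Tendsto s (hyperfilter ℕ : Filter ℕ) (𝓝 σ) := hσ
  rw [FiniteMeasure.tendsto_iff_forall_integral_rclike_tendsto ℂ] at hσt
  refine ⟨σ, fun w hw => ?_⟩
  have hcont : Continuous fun e : Metric.sphere (0 : ℂ) 1 => ((e : ℂ) + w) / ((e : ℂ) - w) := by
    refine Continuous.div (by fun_prop) (by fun_prop) fun e h => ?_
    have he := mem_sphere_zero_iff_norm.1 e.2
    rw [sub_eq_zero.1 h] at he
    linarith
  have h1 := hσt (BoundedContinuousFunction.mkOfCompact ⟨_, hcont⟩)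
  simp only [BoundedContinuousFunction.mkOfCompact_apply, ContinuousMap.coe_mk, hs _ w hw] at h1
  have h2 : Tendsto (fun n => f ((r n : ℂ) * w)) (hyperfilter ℕ : Filter ℕ) (𝓝 (f w)) := by
    refine Tendsto.mono_left ?_ Nat.hyperfilter_le_atTop
    have hfw : ContinuousAt f w :=
      (hf.differentiableAt (Metric.isOpen_ball.mem_nhds (by simpa using hw))).continuousAt
    refine hfw.tendsto.comp ?_
    have := ((Complex.continuous_ofReal.tendsto 1).comp hrt).mul_const w
    simpa [Function.comp_def] using this
  have h3 := tendsto_nhds_unique (h2.sub_const _) h1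
  rw [← h3]
  ring

/-- The boundary values of the Cayley transform. -/
def cayleyBoundary (e : Metric.sphere (0 : ℂ) 1) : ℝ := -(e : ℂ).im / (1 - (e : ℂ).re)

theorem measurable_cayleyBoundary : Measurable cayleyBoundary := by
  unfold cayleyBoundary
  have h1 : Measurable fun e : Metric.sphere (0 : ℂ) 1 => (e : ℂ).im := by fun_prop
  have h2 : Measurable fun e : Metric.sphere (0 : ℂ) 1 => (e : ℂ).re := by fun_prop
  exact h1.neg.div (h2.const_sub 1)

theorem ofReal_cayleyBoundary {e : Metric.sphere (0 : ℂ) 1} (he : (e : ℂ) ≠ 1) :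
    (cayleyBoundary e : ℂ) = Complex.I * (1 + e) / (1 - e) := by
  have h1 : (1 : ℂ) - e ≠ 0 := sub_ne_zero.2 he.symm
  have hn : (e : ℂ).re ^ 2 + (e : ℂ).im ^ 2 = 1 := by
    have := mem_sphere_zero_iff_norm.1 e.2
    have h2 := Complex.sq_norm (e : ℂ)
    rw [this, Complex.normSq_apply] at h2
    linarith
  have h3 : 1 - (e : ℂ).re ≠ 0 := by
    intro h
    apply he
    have h4 : (e : ℂ).re = 1 := by linarith
    have h5 : (e : ℂ).im = 0 := by
      rw [h4] at hn
      have : (e : ℂ).im ^ 2 = 0 := by linarith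
      exact pow_eq_zero_iff (two_ne_zero) |>.1 this
    exact Complex.ext h4 h5
  have hx : cayleyBoundary e * (1 - (e : ℂ).re) = -(e : ℂ).im := by
    rw [cayleyBoundary, div_mul_cancel₀ _ h3]
  rw [eq_div_iff h1]
  apply Complex.ext
  · simpa using hx
  · simp only [Complex.mul_im, Complex.ofReal_re, Complex.ofReal_im, Complex.sub_im,
      Complex.sub_re, Complex.add_re, Complex.add_im, Complex.one_re, Complex.one_im,
      Complex.I_re, Complex.I_im]
    refine mul_right_cancel₀ h3 ?_
    linear_combination (-(e : ℂ).im) * hx + hn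

/-- With `e = (x - i) / (x + i)` both sides equal `(1 + xz) / (x - z)`. This matches the disc kernel
with the line kernel and explains the density `1 + x²`. -/
theorem I_mul_kernel_eq {z : ℂ} (hz : 0 < z.im) {e : Metric.sphere (0 : ℂ) 1} (he : (e : ℂ) ≠ 1) :
    Complex.I * (((e : ℂ) + (z - Complex.I) / (z + Complex.I)) /
      ((e : ℂ) - (z - Complex.I) / (z + Complex.I))) =
      (1 + cayleyBoundary e ^ 2 : ℝ) • herglotzKernel z (cayleyBoundary e) := by
  have h1 : (1 : ℂ) - e ≠ 0 := sub_ne_zero.2 he.symm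
  have hx := ofReal_cayleyBoundary he
  set x := cayleyBoundary e
  have hxi : (x : ℂ) + Complex.I ≠ 0 := by
    intro h
    have := congrArg Complex.im h
    simp at this
  have hzi : z + Complex.I ≠ 0 := by
    intro h
    have := congrArg Complex.im h
    simp at this
    linarith
  have hxz := ofReal_sub_ne_zero hz x
  have hx2 := one_add_ofReal_sq_ne_zero x
  have hee : (e : ℂ) = (x - Complex.I) / (x + Complex.I) := by
    rw [eq_div_iff hxi]
    rw [eq_div_iff h1] at hx
    linear_combination -hx
  rw [herglotzKernel_eq hz, hee, Complex.real_smul]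
  push_cast
  have hI := Complex.I_sq
  have hd : ((x : ℂ) - Complex.I) / (x + Complex.I) - (z - Complex.I) / (z + Complex.I) =
      2 * Complex.I * (x - z) / ((x + Complex.I) * (z + Complex.I)) := by
    field_simp
    ring
  have hs : ((x : ℂ) - Complex.I) / (x + Complex.I) + (z - Complex.I) / (z + Complex.I) =
      2 * (x * z + 1) / ((x + Complex.I) * (z + Complex.I)) := by
    field_simp
    linear_combination (-2 : ℂ) * hI
  have hI0 := Complex.I_ne_zero
  rw [hd, hs]
  field_simp
  ring

/-- The Herglotz representation theorem on the upper half-plane. -/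
theorem exists_isHerglotzRep {M : ℂ → ℂ} (hd : DifferentiableOn ℂ M {z | 0 < z.im})
    (hM : ∀ z : ℂ, 0 < z.im → 0 ≤ (M z).im) : ∃ A B μ, IsHerglotzRep M A B μ := by
  set c : ℂ → ℂ := fun w => Complex.I * (1 + w) / (1 - w) with hc
  have hne : ∀ w : ℂ, ‖w‖ < 1 → 1 - w ≠ 0 := by
    intro w hw h
    rw [← sub_eq_zero.1 h, norm_one] at hw
    exact lt_irrefl _ hw
  have hcim : ∀ w : ℂ, ‖w‖ < 1 → 0 < (c w).im := by
    intro w hw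
    have h1 : (c w).im = (1 - Complex.normSq w) / Complex.normSq (1 - w) := by
      have : Complex.normSq (1 - w) ≠ 0 := by simpa using hne w hw
      rw [hc, Complex.div_im, ← sub_div]
      congr 1
      simp [Complex.normSq_apply]
      ring
    rw [h1]
    refine div_pos ?_ (Complex.normSq_pos.2 (hne w hw))
    rw [Complex.normSq_eq_norm_sq]
    nlinarith [norm_nonneg w]
  have hf : DifferentiableOn ℂ (fun w => -Complex.I * M (c w)) (Metric.ball 0 1) := by
    refine DifferentiableOn.const_mul (hd.comp ?_ fun w hw => hcim w (by simpa using hw)) _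
    refine DifferentiableOn.div (by fun_prop) (by fun_prop) fun w hw => hne w (by simpa using hw)
  obtain ⟨σ, hσ⟩ := exists_measure_disc hf (fun w hw => by simpa using hM _ (hcim w hw))
  set ν : Measure (Metric.sphere (0 : ℂ) 1) := (σ : Measure (Metric.sphere (0 : ℂ) 1)) with hν
  set p : Metric.sphere (0 : ℂ) 1 := ⟨1, by simp⟩ with hp
  have hdens : Measurable fun e => ENNReal.ofReal (1 + cayleyBoundary e ^ 2) :=
    ((measurable_cayleyBoundary.pow_const 2).const_add 1).ennreal_ofReal
  -- The boundary point `1` corresponds to infinity, so its mass is the linear coefficient; the rest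
  -- is carried to the line with density `1 + x²`, and its weighted mass is `ν {p}ᶜ`.
  refine ⟨ν.real {p}, (M Complex.I).re,
    ((ν.restrict {p}ᶜ).withDensity fun e => ENNReal.ofReal (1 + cayleyBoundary e ^ 2)).map
      cayleyBoundary, measureReal_nonneg, ?_, fun z hz => ?_⟩
  · rw [lintegral_map (by fun_prop) measurable_cayleyBoundary,
      lintegral_withDensity_eq_lintegral_mul _ hdens
        (g := fun e => ENNReal.ofReal (1 / (1 + cayleyBoundary e ^ 2)))
        ((((measurable_cayleyBoundary.pow_const 2).const_add 1).const_div 1).ennreal_ofReal)]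
    have : ∀ e, ((fun e => ENNReal.ofReal (1 + cayleyBoundary e ^ 2)) *
        (fun e => ENNReal.ofReal (1 / (1 + cayleyBoundary e ^ 2)))) e = 1 := by
      intro e
      have : (0 : ℝ) < 1 + cayleyBoundary e ^ 2 := by positivity
      rw [Pi.mul_apply, ← ENNReal.ofReal_mul this.le, mul_one_div_cancel this.ne',
        ENNReal.ofReal_one]
    simp only [this, lintegral_const, one_mul]
    exact measure_lt_top _ _
  · change M z = _ + ∫ x, herglotzKernel z x ∂_
    have hzi : z + Complex.I ≠ 0 := by
      intro h
      have := congrArg Complex.im h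
      simp at this
      linarith
    have hw : ‖(z - Complex.I) / (z + Complex.I)‖ < 1 := by
      rw [norm_div, div_lt_one (norm_pos_iff.2 hzi), ← sq_lt_sq₀ (norm_nonneg _) (norm_nonneg _),
        Complex.sq_norm, Complex.sq_norm, Complex.normSq_apply, Complex.normSq_apply]
      simp
      nlinarith
    have hcw : c ((z - Complex.I) / (z + Complex.I)) = z := by
      have hw1 := hne _ hw
      rw [hc]
      simp only
      rw [div_eq_iff hw1]
      field_simp
      ring
    have h0 : c 0 = Complex.I := by simp [hc]
    have h1 := hσ _ hw
    simp only [hcw, h0] at h1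
    have hH : Integrable (fun e : Metric.sphere (0 : ℂ) 1 =>
        ((e : ℂ) + (z - Complex.I) / (z + Complex.I)) /
          ((e : ℂ) - (z - Complex.I) / (z + Complex.I))) ν := by
      have hcont : Continuous (fun e : Metric.sphere (0 : ℂ) 1 =>
        ((e : ℂ) + (z - Complex.I) / (z + Complex.I)) /
          ((e : ℂ) - (z - Complex.I) / (z + Complex.I))) := by
        refine Continuous.div (by fun_prop) (by fun_prop) fun e h => ?_
        have he := mem_sphere_zero_iff_norm.1 e.2
        rw [sub_eq_zero.1 h] at he
        exact hw.ne he
      exact hcont.integrable_of_hasCompactSupport (HasCompactSupport.of_compactSpace _)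
    have h2 : ∫ e in {p}ᶜ, ((e : ℂ) + (z - Complex.I) / (z + Complex.I)) /
          ((e : ℂ) - (z - Complex.I) / (z + Complex.I)) ∂ν =
        -Complex.I * ∫ x, herglotzKernel z x ∂((ν.restrict {p}ᶜ).withDensity
          fun e => ENNReal.ofReal (1 + cayleyBoundary e ^ 2)).map cayleyBoundary := by
      rw [integral_map measurable_cayleyBoundary.aemeasurable
        (measurable_herglotzKernel z).aestronglyMeasurable,
        integral_withDensity_eq_integral_toReal_smul hdens
          (Eventually.of_forall fun _ => ENNReal.ofReal_lt_top), ← integral_const_mul]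
      refine setIntegral_congr_fun (measurableSet_singleton p).compl fun e he => ?_
      have he' : (e : ℂ) ≠ 1 := fun h => he (Subtype.ext h)
      have h3 := I_mul_kernel_eq hz he'
      rw [ENNReal.toReal_ofReal (by positivity), ← h3, ← mul_assoc]
      simp
    rw [← integral_add_compl (measurableSet_singleton p) hH, h2, integral_singleton] at h1
    have h4 : Complex.I * ((1 + (z - Complex.I) / (z + Complex.I)) /
        (1 - (z - Complex.I) / (z + Complex.I))) = z := by
      rw [← mul_div_assoc]; exact hcw
    have h5 : M z = Complex.I * (-Complex.I * M z) := by
      linear_combination (M z) * Complex.I_sq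
    rw [h5, h1]
    have h6 : (-Complex.I * M Complex.I).im = -(M Complex.I).re := by simp
    rw [h6, Complex.real_smul]
    push_cast
    simp only [hp]
    linear_combination ((ν.real {p} : ℂ)) * h4 + (-(M Complex.I).re - ∫ x, herglotzKernel z x ∂
      (((ν.restrict {p}ᶜ).withDensity
          fun e => ENNReal.ofReal (1 + cayleyBoundary e ^ 2)).map cayleyBoundary)) * Complex.I_sq

/-! ### Boundary behaviour of the imaginary part. -/

theorem add_mul_I_im (l ε : ℝ) : ((l : ℂ) + ε * Complex.I).im = ε := by simp

theorem add_mul_I_re (l ε : ℝ) : ((l : ℂ) + ε * Complex.I).re = l := by simp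

/-- On the ball of radius `ε` the kernel is at least `1 / (2ε)`, the reciprocal of the volume. -/
theorem measure_closedBall_div_le_lintegral_poisson (μ : Measure ℝ) {ε : ℝ} (hε : 0 < ε) (l : ℝ) :
    μ (Metric.closedBall l ε) / volume (Metric.closedBall l ε) ≤
      ∫⁻ x, ENNReal.ofReal (poisson l ε x) ∂μ := by
  rw [Real.volume_closedBall, div_eq_mul_inv, mul_comm, ← ENNReal.ofReal_inv_of_pos (by positivity)]
  refine le_trans ?_ (setLIntegral_le_lintegral (Metric.closedBall l ε) _)
  rw [← setLIntegral_const]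
  refine setLIntegral_mono' measurableSet_closedBall fun x hx => ENNReal.ofReal_le_ofReal ?_
  rw [Metric.mem_closedBall, Real.dist_eq] at hx
  have h1 : (x - l) ^ 2 ≤ ε ^ 2 := by
    rw [← sq_abs]
    gcongr
  rw [poisson, inv_eq_one_div, div_le_div_iff₀ (by positivity) (by positivity)]
  nlinarith

theorem IsHerglotzRep.measure_closedBall_div_le {M : ℂ → ℂ} {A B : ℝ} {μ : Measure ℝ}
    (h : IsHerglotzRep M A B μ) {ε : ℝ} (hε : 0 < ε) (l : ℝ) :
    μ (Metric.closedBall l ε) / volume (Metric.closedBall l ε) ≤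
      ENNReal.ofReal (M (l + ε * Complex.I)).im := by
  have hz : 0 < ((l : ℂ) + ε * Complex.I).im := by simpa using hε
  rw [h.ofReal_im hz]
  simp only [add_mul_I_im, add_mul_I_re]
  exact (measure_closedBall_div_le_lintegral_poisson μ hε l).trans le_add_self

/-- The imaginary part blows up almost everywhere with respect to the singular part. -/
theorem IsHerglotzRep.ae_singularPart_tendsto {M : ℂ → ℂ} {A B : ℝ} {μ : Measure ℝ}
    (h : IsHerglotzRep M A B μ) :
    ∀ᵐ l : ℝ ∂(μ.singularPart volume),
      Tendsto (fun ε : ℝ => (M (l + ε * Complex.I)).im) (𝓝[>] 0) atTop := by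
  have := h.isLocallyFiniteMeasure
  have hle : μ.singularPart volume ≤ μ := Measure.singularPart_le _ _
  have : IsLocallyFiniteMeasure (μ.singularPart volume) := Measure.isLocallyFiniteMeasure_of_le hle
  -- Lebesgue measure is differentiated with respect to the singular part. The derivative is zero,
  -- so the inverse ratio, which `Im M` dominates, tends to infinity.
  have h0 : volume.rnDeriv (μ.singularPart volume) =ᵐ[μ.singularPart volume] 0 :=
    (Measure.mutuallySingular_singularPart μ volume).symm.rnDeriv_ae_eq_zero
  filter_upwards [Besicovitch.ae_tendsto_rnDeriv volume (μ.singularPart volume), h0] with l hl hl0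
  rw [hl0] at hl
  have h1 := tendsto_inv_iff.2 hl
  simp only [Pi.zero_apply, ENNReal.inv_zero] at h1
  have h2 : Tendsto (fun ε : ℝ => ENNReal.ofReal (M (l + ε * Complex.I)).im) (𝓝[>] 0) (𝓝 ⊤) := by
    refine tendsto_nhds_top_mono h1 ?_
    filter_upwards [self_mem_nhdsWithin] with ε hε
    refine le_trans ?_ (h.measure_closedBall_div_le hε l)
    have hv : volume (Metric.closedBall l ε) ≠ 0 := by
      rw [Real.volume_closedBall]; simpa using hε
    have hv' : volume (Metric.closedBall l ε) ≠ ⊤ := by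
      rw [Real.volume_closedBall]; exact ENNReal.ofReal_ne_top
    rw [ENNReal.inv_div (Or.inr hv') (Or.inr hv)]
    gcongr
  exact ENNReal.tendsto_ofReal_nhds_top.1 h2

/-- The weight in the layer cake formula for the Poisson kernel. -/
def layerWeight (s : ℝ) : ℝ := 4 * s ^ 2 / (1 + s ^ 2) ^ 2

theorem lintegral_Ici_layer {c : ℝ} (hc : 0 ≤ c) :
    ∫⁻ s in Ici c, ENNReal.ofReal (2 * s / (1 + s ^ 2) ^ 2) = ENNReal.ofReal (1 / (1 + c ^ 2)) := by
  have hd : ∀ x ∈ Ici c, HasDerivAt (fun s : ℝ => -(1 / (1 + s ^ 2)))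
      (2 * x / (1 + x ^ 2) ^ 2) x := by
    intro x _
    have h0 : (1 : ℝ) + x ^ 2 ≠ 0 := by positivity
    have := (((hasDerivAt_id x).pow 2).const_add 1).inv h0
    convert! this.neg using 1
    · ext s; simp
    · simp; ring
  have ht : Tendsto (fun s : ℝ => -(1 / (1 + s ^ 2))) atTop (𝓝 0) := by
    have : Tendsto (fun s : ℝ => (1 + s ^ 2)⁻¹) atTop (𝓝 0) :=
      tendsto_inv_atTop_zero.comp (tendsto_atTop_add_const_left _ _ (tendsto_pow_atTop two_ne_zero))
    simpa using this.neg
  have hn : ∀ x ∈ Ioi c, 0 ≤ 2 * x / (1 + x ^ 2) ^ 2 := by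
    intro x hx
    have : 0 < x := hc.trans_lt hx
    positivity
  have hi := integrableOn_Ioi_deriv_of_nonneg' hd hn ht
  have he := integral_Ioi_of_hasDerivAt_of_nonneg' hd hn ht
  rw [setLIntegral_congr Ioi_ae_eq_Ici.symm, ← ofReal_integral_eq_lintegral_ofReal hi
    ((ae_restrict_iff' measurableSet_Ioi).2 (Eventually.of_forall hn)), he]
  congr 1
  ring

/-- An antiderivative is `2 arctan s - 2s / (1 + s²)`. The total mass is the factor `π` in Fatou's
theorem. -/
theorem lintegral_layerWeight :
    ∫⁻ s in Ioi 0, ENNReal.ofReal (layerWeight s) = ENNReal.ofReal Real.pi := by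
  have hd : ∀ x ∈ Ici (0 : ℝ), HasDerivAt (fun s : ℝ => 2 * Real.arctan s - 2 * s * (1 + s ^ 2)⁻¹)
      (layerWeight x) x := by
    intro x _
    have h0 : (1 : ℝ) + x ^ 2 ≠ 0 := by positivity
    have := ((hasDerivAt_id x).const_mul 2).mul ((((hasDerivAt_id x).pow 2).const_add 1).inv h0)
    convert! ((Real.hasDerivAt_arctan x).const_mul 2).sub this using 1
    simp [layerWeight]
    field_simp
    ring
  have ht : Tendsto (fun s : ℝ => 2 * Real.arctan s - 2 * s * (1 + s ^ 2)⁻¹) atTop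
      (𝓝 Real.pi) := by
    have h1 := (Real.tendsto_arctan_atTop.mono_right nhdsWithin_le_nhds).const_mul 2
    have h2 : Tendsto (fun s : ℝ => 2 * s * (1 + s ^ 2)⁻¹) atTop (𝓝 0) := by
      refine squeeze_zero' (g := fun s => 2 * s⁻¹) ?_ ?_ ?_
      · filter_upwards [eventually_gt_atTop 0] with s hs
        positivity
      · filter_upwards [eventually_gt_atTop 0] with s hs
        rw [mul_assoc]
        gcongr
        rw [← div_eq_mul_inv, div_le_iff₀ (by positivity)]
        field_simp
        linarith
      · simpa using tendsto_inv_atTop_zero.const_mul (2 : ℝ)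
    have := h1.sub h2
    convert! this using 2
    ring
  have hn : ∀ x ∈ Ioi (0 : ℝ), 0 ≤ layerWeight x := by
    intro x hx
    unfold layerWeight
    positivity
  have hi := integrableOn_Ioi_deriv_of_nonneg' hd hn ht
  have he := integral_Ioi_of_hasDerivAt_of_nonneg' hd hn ht
  rw [← ofReal_integral_eq_lintegral_ofReal hi
    ((ae_restrict_iff' measurableSet_Ioi).2 (Eventually.of_forall hn)), he]
  simp

theorem measurable_layerWeight : Measurable layerWeight := by unfold layerWeight; fun_prop

/-- The layer cake formula for the Poisson integral. -/
theorem lintegral_poisson_eq_layer (μ : Measure ℝ) [SFinite μ] {ε : ℝ} (hε : 0 < ε) (l : ℝ) :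
    ∫⁻ x, ENNReal.ofReal (poisson l ε x) ∂μ =
      ∫⁻ s in Ioi 0, ENNReal.ofReal (layerWeight s) *
        (μ (Metric.closedBall l (ε * s)) / volume (Metric.closedBall l (ε * s))) := by
  have h1 : ∀ x, ENNReal.ofReal (poisson l ε x) = ∫⁻ s in Ioi 0,
      {p : ℝ × ℝ | |p.1 - l| ≤ ε * p.2}.indicator
        (fun p => ENNReal.ofReal (ε⁻¹ * (2 * p.2 / (1 + p.2 ^ 2) ^ 2))) (x, s) := by
    intro x
    have h2 : poisson l ε x = ε⁻¹ * (1 / (1 + (|x - l| / ε) ^ 2)) := by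
      rw [div_pow, sq_abs, poisson]
      field_simp
      ring
    rw [h2, ENNReal.ofReal_mul (by positivity), ← lintegral_Ici_layer (by positivity),
      ← lintegral_const_mul' _ _ ENNReal.ofReal_ne_top,
      ← lintegral_indicator measurableSet_Ici, ← lintegral_indicator measurableSet_Ioi]
    refine lintegral_congr_ae ?_
    filter_upwards [Measure.ae_ne volume (0 : ℝ)] with s hs
    by_cases hxs : |x - l| ≤ ε * s
    · have hs0 : 0 < s := by
        have : 0 ≤ ε * s := (abs_nonneg _).trans hxs
        exact lt_of_le_of_ne (nonneg_of_mul_nonneg_right this hε) hs.symm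
      rw [indicator_of_mem (by simpa [div_le_iff₀' hε] using hxs), indicator_of_mem (by simpa),
        indicator_of_mem (by simpa using hxs), ENNReal.ofReal_mul (by positivity)]
    · rw [indicator_of_notMem (by simpa [div_le_iff₀' hε] using hxs)]
      by_cases hs0 : s ∈ Ioi (0 : ℝ)
      · rw [indicator_of_mem hs0, indicator_of_notMem (by simpa using hxs)]
      · rw [indicator_of_notMem hs0]
  have hm : MeasurableSet {p : ℝ × ℝ | |p.1 - l| ≤ ε * p.2} :=
    measurableSet_le (by fun_prop) (by fun_prop)
  simp only [h1]
  rw [lintegral_lintegral_swap]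
  · refine setLIntegral_congr_fun measurableSet_Ioi fun s hs => ?_
    have hs0 : 0 < s := hs
    have h3 : ∀ x, {p : ℝ × ℝ | |p.1 - l| ≤ ε * p.2}.indicator
        (fun p => ENNReal.ofReal (ε⁻¹ * (2 * p.2 / (1 + p.2 ^ 2) ^ 2))) (x, s) =
        (Metric.closedBall l (ε * s)).indicator
          (fun _ => ENNReal.ofReal (ε⁻¹ * (2 * s / (1 + s ^ 2) ^ 2))) x := by
      intro x
      simp only [indicator, mem_ofPred_eq, Metric.mem_closedBall, Real.dist_eq]
    simp only [h3]
    rw [lintegral_indicator_const measurableSet_closedBall, Real.volume_closedBall,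
      ENNReal.div_eq_inv_mul, ← mul_assoc, ← ENNReal.ofReal_inv_of_pos (by positivity),
      ← ENNReal.ofReal_mul (by unfold layerWeight; positivity)]
    congr 2
    unfold layerWeight
    field_simp
    norm_num
  · refine Measurable.aemeasurable ?_
    refine Measurable.indicator ?_ hm
    fun_prop

/-- In the layer cake formula the ball ratios at radius `ε s` tend to `D` for each `s > 0`. They are
uniformly bounded, by convergence at small radii and by the finite total mass at large ones, so
dominated convergence applies. -/
theorem tendsto_lintegral_poisson {μ : Measure ℝ} [IsFiniteMeasure μ] {l : ℝ} {D : ENNReal}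
    (hD : D ≠ ⊤) (h : Tendsto (fun r => μ (Metric.closedBall l r) /
      volume (Metric.closedBall l r)) (𝓝[>] 0) (𝓝 D)) :
    Tendsto (fun ε : ℝ => ∫⁻ x, ENNReal.ofReal (poisson l ε x) ∂μ) (𝓝[>] 0)
      (𝓝 (ENNReal.ofReal Real.pi * D)) := by
  set g : ℝ → ENNReal := fun r => μ (Metric.closedBall l r) / volume (Metric.closedBall l r)
    with hg
  obtain ⟨C, hC, hgC⟩ : ∃ C : ENNReal, C ≠ ⊤ ∧ ∀ r, 0 < r → g r ≤ C := by
    have hev : ∀ᶠ r in 𝓝[>] (0 : ℝ), g r < D + 1 :=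
      h.eventually_lt_const (ENNReal.lt_add_right hD one_ne_zero)
    obtain ⟨r₀, hr₀, hr⟩ := mem_nhdsGT_iff_exists_Ioo_subset.1 hev
    refine ⟨max (D + 1) (μ univ / ENNReal.ofReal (2 * r₀)), ?_, fun r hr0 => ?_⟩
    · refine (max_lt (ENNReal.add_lt_top.2 ⟨hD.lt_top, ENNReal.one_lt_top⟩) ?_).ne
      refine ENNReal.div_lt_top (measure_ne_top _ _) ?_
      have : 0 < r₀ := hr₀
      simpa using this
    · rcases lt_or_ge r r₀ with hlt | hge
      · exact le_max_of_le_left (hr ⟨hr0, hlt⟩).le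
      · refine le_max_of_le_right ?_
        simp only [hg, Real.volume_closedBall]
        gcongr
        exact subset_univ _
  have hgm : Measurable g := by
    have h1 : Monotone fun r => μ (Metric.closedBall l r) :=
      fun r r' hrr => measure_mono (Metric.closedBall_subset_closedBall hrr)
    have h2 : Monotone fun r => volume (Metric.closedBall l r) :=
      fun r r' hrr => measure_mono (Metric.closedBall_subset_closedBall hrr)
    exact h1.measurable.div h2.measurable
  have hlim : Tendsto (fun ε : ℝ => ∫⁻ s in Ioi 0, ENNReal.ofReal (layerWeight s) * g (ε * s))
      (𝓝[>] 0) (𝓝 (∫⁻ s in Ioi 0, ENNReal.ofReal (layerWeight s) * D)) := by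
    refine tendsto_lintegral_filter_of_dominated_convergence
      (fun s => ENNReal.ofReal (layerWeight s) * C) ?_ ?_ ?_ ?_
    · exact Eventually.of_forall fun ε =>
        measurable_layerWeight.ennreal_ofReal.mul (hgm.comp (measurable_const_mul ε))
    · filter_upwards [self_mem_nhdsWithin] with ε hε
      refine (ae_restrict_iff' measurableSet_Ioi).2 (Eventually.of_forall fun s hs => ?_)
      gcongr
      exact hgC _ (mul_pos (mem_Ioi.1 hε) (mem_Ioi.1 hs))
    · rw [lintegral_mul_const _ measurable_layerWeight.ennreal_ofReal, lintegral_layerWeight]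
      exact ENNReal.mul_ne_top ENNReal.ofReal_ne_top hC
    · refine (ae_restrict_iff' measurableSet_Ioi).2 (Eventually.of_forall fun s hs => ?_)
      refine ENNReal.Tendsto.const_mul (h.comp ?_) (Or.inr ENNReal.ofReal_ne_top)
      refine tendsto_nhdsWithin_iff.2 ⟨?_, ?_⟩
      · have : Tendsto (fun ε : ℝ => ε * s) (𝓝 0) (𝓝 (0 * s)) :=
          (continuous_mul_const s).tendsto 0
        rw [zero_mul] at this
        exact this.mono_left nhdsWithin_le_nhds
      · filter_upwards [self_mem_nhdsWithin] with ε hε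
        exact mul_pos (mem_Ioi.1 hε) (mem_Ioi.1 hs)
  rw [lintegral_mul_const _ measurable_layerWeight.ennreal_ofReal, lintegral_layerWeight] at hlim
  refine hlim.congr' ?_
  filter_upwards [self_mem_nhdsWithin] with ε hε
  rw [lintegral_poisson_eq_layer μ hε]

/-- Away from `l` the Poisson kernel is at most `ε (3 + 2l²) / (1 + x²)`. -/
theorem tendsto_lintegral_poisson_compl {μ : Measure ℝ}
    (hμ : Integrable (fun x : ℝ => 1 / (1 + x ^ 2)) μ) (l : ℝ) :
    Tendsto (fun ε : ℝ => ∫⁻ x in (Metric.closedBall l 1)ᶜ, ENNReal.ofReal (poisson l ε x) ∂μ)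
      (𝓝[>] 0) (𝓝 0) := by
  set c : ENNReal := ∫⁻ x, ENNReal.ofReal ((3 + 2 * l ^ 2) * (1 / (1 + x ^ 2))) ∂μ with hc
  have hct : c ≠ ⊤ := ((hμ.const_mul _).lintegral_lt_top).ne
  have h0 : Tendsto (fun ε : ℝ => ENNReal.ofReal ε * c) (𝓝[>] 0) (𝓝 0) := by
    have : Tendsto (fun ε : ℝ => ENNReal.ofReal ε * c) (𝓝 0) (𝓝 (ENNReal.ofReal 0 * c)) :=
      ENNReal.Tendsto.mul_const (ENNReal.continuous_ofReal.tendsto 0) (Or.inr hct)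
    rw [ENNReal.ofReal_zero, zero_mul] at this
    exact this.mono_left nhdsWithin_le_nhds
  refine tendsto_of_tendsto_of_tendsto_of_le_of_le' tendsto_const_nhds h0
    (Eventually.of_forall fun _ => zero_le) ?_
  filter_upwards [self_mem_nhdsWithin] with ε hε
  have hε' : 0 < ε := hε
  rw [hc, ← lintegral_const_mul' _ _ ENNReal.ofReal_ne_top]
  refine le_trans ?_ (setLIntegral_le_lintegral (Metric.closedBall l 1)ᶜ _)
  refine setLIntegral_mono' measurableSet_closedBall.compl fun x hx => ?_
  rw [← ENNReal.ofReal_mul hε'.le]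
  refine ENNReal.ofReal_le_ofReal ?_
  rw [mem_compl_iff, Metric.mem_closedBall, not_le, Real.dist_eq] at hx
  have h1 : 1 < (x - l) ^ 2 := by
    rw [← sq_abs]
    nlinarith
  rw [poisson, mul_one_div, div_eq_mul_one_div]
  refine mul_le_mul_of_nonneg_left ?_ hε'.le
  rw [div_le_div_iff₀ (by positivity) (by positivity)]
  nlinarith [sq_nonneg (x - 2 * l), mul_nonneg (sq_nonneg l) (sub_nonneg.2 h1.le),
    mul_nonneg (sq_nonneg l) (sq_nonneg ε)]

/-- Fatou's theorem for the imaginary part. -/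
theorem IsHerglotzRep.ae_tendsto_im {M : ℂ → ℂ} {A B : ℝ} {μ : Measure ℝ}
    (h : IsHerglotzRep M A B μ) :
    ∀ᵐ l : ℝ, Tendsto (fun ε : ℝ => (M (l + ε * Complex.I)).im) (𝓝[>] 0)
      (𝓝 (Real.pi * (μ.rnDeriv volume l).toReal)) := by
  have := h.isLocallyFiniteMeasure
  filter_upwards [Besicovitch.ae_tendsto_rnDeriv μ volume, μ.rnDeriv_ne_top volume] with l hl hlt
  -- Only the restriction to a unit ball is a finite measure; the complement contributes nothing in
  -- the limit.
  have hfin : IsFiniteMeasure (μ.restrict (Metric.closedBall l 1)) :=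
    ⟨by rw [Measure.restrict_apply_univ]; exact (isCompact_closedBall l 1).measure_lt_top⟩
  have h1 : Tendsto (fun r => μ.restrict (Metric.closedBall l 1) (Metric.closedBall l r) /
      volume (Metric.closedBall l r)) (𝓝[>] 0) (𝓝 (μ.rnDeriv volume l)) := by
    refine hl.congr' ?_
    filter_upwards [Ioo_mem_nhdsGT zero_lt_one] with r hr
    rw [Measure.restrict_apply measurableSet_closedBall,
      inter_eq_left.2 (Metric.closedBall_subset_closedBall hr.2.le)]
  have h2 := (tendsto_lintegral_poisson hlt h1).add
    (tendsto_lintegral_poisson_compl h.integrable_weight l)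
  have h3 : Tendsto (fun ε : ℝ => ENNReal.ofReal (A * ε)) (𝓝[>] 0) (𝓝 0) := by
    have : Tendsto (fun ε : ℝ => ENNReal.ofReal (A * ε)) (𝓝 0) (𝓝 (ENNReal.ofReal (A * 0))) :=
      ENNReal.tendsto_ofReal ((continuous_const_mul A).tendsto 0)
    rw [mul_zero, ENNReal.ofReal_zero] at this
    exact this.mono_left nhdsWithin_le_nhds
  have h4 := h3.add h2
  rw [zero_add, add_zero] at h4
  have h5 := (ENNReal.tendsto_toReal (ENNReal.mul_ne_top ENNReal.ofReal_ne_top hlt)).comp h4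
  rw [ENNReal.toReal_mul, ENNReal.toReal_ofReal Real.pi_pos.le] at h5
  refine h5.congr' ?_
  filter_upwards [self_mem_nhdsWithin] with ε hε
  have hz : 0 < ((l : ℂ) + ε * Complex.I).im := by simpa using hε
  have h6 := h.ofReal_im hz
  simp only [add_mul_I_im, add_mul_I_re] at h6
  rw [Function.comp_apply, lintegral_add_compl _ measurableSet_closedBall, ← h6,
    ENNReal.toReal_ofReal]
  refine le_trans ?_ (h.mul_im_le hz)
  exact mul_nonneg h.1 hz.le

/-! ### Existence of complex boundary limits. -/

theorem continuousOn_vertical {M : ℂ → ℂ}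
    (hM : ContinuousOn M {z | 0 < z.im}) (l : ℝ) :
    ContinuousOn (fun ε : ℝ => M (l + ε * Complex.I)) (Ioi 0) := by
  refine hM.comp (by fun_prop) fun ε hε => ?_
  simpa using hε

/-- A continuous real function whose exponential on the unit circle converges is itself
convergent. -/
theorem exists_tendsto_of_exp_tendsto {R : ℝ → ℝ} (hR : ContinuousOn R (Ioi 0)) {u : ℂ}
    (h : Tendsto (fun ε => Complex.exp (R ε * Complex.I)) (𝓝[>] 0) (𝓝 u)) :
    ∃ r, Tendsto R (𝓝[>] 0) (𝓝 r) := by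
  suffices Cauchy (map R (𝓝[>] 0)) from CompleteSpace.complete this
  rw [Metric.cauchy_iff]
  refine ⟨inferInstance, fun η hη => ?_⟩
  set η' := min η 1 with hη'
  have hη'0 : 0 < η' := lt_min hη one_pos
  have hd : 0 < ‖Complex.exp (η' * Complex.I) - 1‖ := by
    rw [norm_pos_iff, sub_ne_zero]
    intro hexp
    have h1 := congrArg Complex.im hexp
    rw [Complex.exp_ofReal_mul_I_im, Complex.one_im] at h1
    have h2 : 0 < Real.sin η' := Real.sin_pos_of_pos_of_lt_pi hη'0
      ((min_le_right _ _).trans_lt (by linarith [Real.pi_gt_three]))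
    linarith
  obtain ⟨δ, hδ, hsub⟩ := mem_nhdsGT_iff_exists_Ioo_subset.1
    (h (Metric.ball_mem_nhds u (half_pos hd)))
  have hord : OrdConnected (R '' Ioo 0 δ) :=
    (isPreconnected_Ioo.image R (hR.mono Ioo_subset_Ioi_self)).ordConnected
  -- If `R` varied by `η'` or more, the intermediate value property would give two values differing
  -- by exactly `η'`. Their exponentials would then be a fixed distance apart, arbitrarily close to
  -- the limit.
  have key : ∀ x ∈ R '' Ioo 0 δ, ∀ y ∈ R '' Ioo 0 δ, y - x < η' := by
    intro x hx y hy
    by_contra! hxy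
    obtain ⟨s, hs, hsx⟩ : x + η' ∈ R '' Ioo 0 δ :=
      hord.out hx hy ⟨by linarith, by linarith⟩
    obtain ⟨t, ht, rfl⟩ := hx
    have h1 : dist _ _ < _ := hsub hs
    have h2 : dist _ _ < _ := hsub ht
    have h3 : dist (Complex.exp (R s * Complex.I)) (Complex.exp (R t * Complex.I)) <
        ‖Complex.exp (η' * Complex.I) - 1‖ := by
      refine (dist_triangle_right _ _ u).trans_lt ?_
      linarith
    rw [hsx, Complex.ofReal_add, add_mul, Complex.exp_add, dist_eq_norm] at h3
    rw [← mul_sub_one, norm_mul, Complex.norm_exp_ofReal_mul_I, one_mul] at h3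
    exact lt_irrefl _ h3
  refine ⟨R '' Ioo 0 δ, image_mem_map (Ioo_mem_nhdsGT hδ), fun x hx y hy => ?_⟩
  rw [Real.dist_eq, abs_lt]
  have h1 := key x hx y hy
  have h2 := key y hy x hx
  have h3 : η' ≤ η := min_le_left _ _
  constructor <;> linarith

/-- Bounded analytic functions have vertical boundary limits almost everywhere. -/
theorem ae_exists_tendsto_of_norm_le_one {f : ℂ → ℂ} (hd : DifferentiableOn ℂ f {z | 0 < z.im})
    (hf : ∀ z : ℂ, 0 < z.im → ‖f z‖ ≤ 1) :
    ∀ᵐ l : ℝ, ∃ w, Tendsto (fun ε : ℝ => f (l + ε * Complex.I)) (𝓝[>] 0) (𝓝 w) := by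
  -- Adding `i` to `f` and to `i f` makes the imaginary parts `1 + Im f` and `1 + Re f` nonnegative,
  -- so Fatou's theorem handles both components of `f`.
  obtain ⟨A₁, B₁, μ₁, h₁⟩ := exists_isHerglotzRep (M := fun z => Complex.I + f z)
    (hd.const_add _) fun z hz => by
      have := (abs_le.1 ((Complex.abs_im_le_norm (f z)).trans (hf z hz))).1
      simp only [Complex.add_im, Complex.I_im]
      linarith
  obtain ⟨A₂, B₂, μ₂, h₂⟩ := exists_isHerglotzRep (M := fun z => Complex.I + Complex.I * f z)
    ((hd.const_mul _).const_add _) fun z hz => by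
      have := (abs_le.1 ((Complex.abs_re_le_norm (f z)).trans (hf z hz))).1
      simp only [Complex.add_im, Complex.I_im, Complex.I_mul_im]
      linarith
  filter_upwards [h₁.ae_tendsto_im, h₂.ae_tendsto_im] with l hl₁ hl₂
  have h1 := hl₁.sub_const 1
  have h2 := hl₂.sub_const 1
  simp only [Complex.add_im, Complex.I_im, Complex.I_mul_im, add_sub_cancel_left] at h1 h2
  refine ⟨_, ((Complex.continuous_ofReal.tendsto _).comp h2).add
    (((Complex.continuous_ofReal.tendsto _).comp h1).mul_const Complex.I) |>.congr fun ε => ?_⟩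
  exact Complex.re_add_im _

/-- Herglotz functions have vertical boundary limits almost everywhere. -/
theorem IsHerglotzRep.ae_exists_tendsto {M : ℂ → ℂ} {A B : ℝ} {μ : Measure ℝ}
    (hM : IsHerglotz M) (h : IsHerglotzRep M A B μ) :
    ∀ᵐ l : ℝ, ∃ w : ℂ, w.im = Real.pi * (μ.rnDeriv volume l).toReal ∧
      Tendsto (fun ε : ℝ => M (l + ε * Complex.I)) (𝓝[>] 0) (𝓝 w) := by
  -- `exp (i M)` is bounded by `1`. Since `Im M` already converges, its limit gives one for `exp (i
  -- Re M)`, and continuity in `ε` lifts that to `Re M`.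
  have h1 := ae_exists_tendsto_of_norm_le_one (f := fun z => Complex.exp (Complex.I * M z))
    ((hM.1.const_mul _).cexp) fun z hz => by
      rw [Complex.norm_exp]
      simpa using (hM.2 z hz).le
  filter_upwards [h1, h.ae_tendsto_im] with l ⟨ζ, hζ⟩ him
  have hexp : Tendsto (fun ε : ℝ =>
      Complex.exp ((M (l + ε * Complex.I)).re * Complex.I)) (𝓝[>] 0)
      (𝓝 (ζ * Complex.exp (((Real.pi * (μ.rnDeriv volume l).toReal : ℝ) : ℂ)))) := by
    have h2 := (Complex.continuous_exp.tendsto _).comp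
      ((Complex.continuous_ofReal.tendsto _).comp him)
    refine (hζ.mul h2).congr fun ε => ?_
    simp only [Function.comp_apply]
    rw [← Complex.exp_add]
    congr 1
    nth_rw 1 [← Complex.re_add_im (M (l + ε * Complex.I))]
    linear_combination ((M (l + ε * Complex.I)).im : ℂ) * Complex.I_sq
  obtain ⟨r, hr⟩ := exists_tendsto_of_exp_tendsto (Complex.continuous_re.comp_continuousOn
    (continuousOn_vertical hM.1.continuousOn l)) hexp
  refine ⟨⟨r, Real.pi * (μ.rnDeriv volume l).toReal⟩, rfl, ?_⟩
  have h3 := ((Complex.continuous_ofReal.tendsto _).comp hr).add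
    (((Complex.continuous_ofReal.tendsto _).comp him).mul_const Complex.I)
  have h4 : ((r : ℂ) + ((Real.pi * (μ.rnDeriv volume l).toReal : ℝ) : ℂ) * Complex.I) =
      ⟨r, Real.pi * (μ.rnDeriv volume l).toReal⟩ := by
    apply Complex.ext <;> simp
  rw [h4] at h3
  exact h3.congr fun ε => Complex.re_add_im _

/-! ### Measurability of `𝒜`, `𝒮` and `𝒫`. -/

/-- The positive rationals converging to zero from the right. -/
def posRatFilter : Filter {q : ℚ // 0 < q} := comap (fun q => ((q : ℚ) : ℝ)) (𝓝[>] 0)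

instance : posRatFilter.IsCountablyGenerated := by
  unfold posRatFilter; infer_instance

theorem eventually_posRatFilter {p : {q : ℚ // 0 < q} → Prop} :
    (∀ᶠ q in posRatFilter, p q) ↔ ∃ δ : ℝ, 0 < δ ∧ ∀ q : {q : ℚ // 0 < q}, (q : ℝ) < δ → p q := by
  rw [posRatFilter, ((nhdsGT_basis (0 : ℝ)).comap _).eventually_iff]
  constructor
  · rintro ⟨δ, hδ, h⟩
    exact ⟨δ, hδ, fun q hq => h ⟨Rat.cast_pos.2 q.2, hq⟩⟩
  · rintro ⟨δ, hδ, h⟩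
    exact ⟨δ, hδ, fun q hq => h q hq.2⟩

instance : posRatFilter.NeBot := by
  refine ⟨fun h => ?_⟩
  have h1 : ∀ᶠ q in posRatFilter, False := by rw [h]; exact eventually_bot
  obtain ⟨δ, hδ, hq⟩ := eventually_posRatFilter.1 h1
  obtain ⟨q, hq0, hqδ⟩ := exists_rat_btwn hδ
  exact hq ⟨q, by exact_mod_cast hq0⟩ hqδ

/-- By density and continuity, a closed neighbourhood containing the values at small rationals
contains those at all small `ε`. -/
theorem tendsto_posRatFilter_iff {E : Type*} [TopologicalSpace E] [RegularSpace E] {f : ℝ → E}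
    (hf : ContinuousOn f (Ioi 0)) {w : E} :
    Tendsto (fun q : {q : ℚ // 0 < q} => f (q : ℚ)) posRatFilter (𝓝 w) ↔
      Tendsto f (𝓝[>] 0) (𝓝 w) := by
  refine ⟨fun h => ?_, fun h => h.comp tendsto_comap⟩
  refine (closed_nhds_basis w).tendsto_right_iff.2 fun K hK => ?_
  obtain ⟨δ, hδ, hq⟩ := eventually_posRatFilter.1 (h.eventually_mem hK.1)
  filter_upwards [Ioo_mem_nhdsGT hδ] with ε hε
  have hε' : ε ∈ closure (Ioo 0 δ ∩ range ((↑) : ℚ → ℝ)) := 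
    Rat.denseRange_cast.open_subset_closure_inter isOpen_Ioo hε
  have hc : ContinuousWithinAt f (Ioo 0 δ ∩ range ((↑) : ℚ → ℝ)) ε :=
    (hf ε hε.1).mono fun x hx => hx.1.1
  have := hc.mem_closure hε' (t := K) ?_
  · rwa [hK.2.closure_eq] at this
  · rintro _ ⟨hx, q, rfl⟩
    exact hq ⟨q, by exact_mod_cast hx.1⟩ hx.2

/-- Restricting to rational `ε` makes convergence a measurable condition. Positivity of the limit is
a countable one: for some `k`, the values are eventually at least `1 / (k + 1)`. -/
theorem measurableSet_exists_pos_tendsto {E : Type*} [MetricSpace E] [CompleteSpace E]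
    [SecondCountableTopology E] [MeasurableSpace E] [BorelSpace E] {f : ℝ → ℝ → E}
    (hf : ∀ l, ContinuousOn (f l) (Ioi 0)) (hm : ∀ ε, 0 < ε → Measurable fun l => f l ε)
    {p : E → ℝ} (hp : Continuous p) :
    MeasurableSet {l | ∃ w, 0 < p w ∧ Tendsto (f l) (𝓝[>] 0) (𝓝 w)} := by
  have hm' : ∀ q : {q : ℚ // 0 < q}, Measurable fun l => f l (q : ℚ) :=
    fun q => hm _ (by exact_mod_cast q.2)
  have h1 : MeasurableSet {l | ∃ w, Tendsto (fun q : {q : ℚ // 0 < q} => f l (q : ℚ))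
      posRatFilter (𝓝 w)} := measurableSet_exists_tendsto hm'
  have h2 : MeasurableSet (⋃ (k : ℕ) (n : ℕ), ⋂ (q : {q : ℚ // 0 < q})
      (_ : ((q : ℚ) : ℝ) < 1 / ((n : ℝ) + 1)),
      {l | 1 / ((k : ℝ) + 1) ≤ p (f l (q : ℚ))}) := by
    refine MeasurableSet.iUnion fun k => MeasurableSet.iUnion fun n =>
      MeasurableSet.iInter fun q => MeasurableSet.iInter fun _ => ?_
    exact measurableSet_le measurable_const (hp.measurable.comp (hm' q))
  convert h1.inter h2 using 1
  ext l
  simp only [mem_inter_iff, mem_iUnion, mem_iInter, mem_ofPred_eq]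
  constructor
  · rintro ⟨w, hw, h⟩
    have h' := (tendsto_posRatFilter_iff (hf l)).2 h
    refine ⟨⟨w, h'⟩, ?_⟩
    obtain ⟨k, hk⟩ := exists_nat_one_div_lt hw
    obtain ⟨δ, hδ, hq⟩ := eventually_posRatFilter.1
      (((hp.tendsto w).comp h').eventually_const_le hk)
    obtain ⟨n, hn⟩ := exists_nat_one_div_lt hδ
    exact ⟨k, n, fun q hqn => hq q (hqn.trans hn)⟩
  · rintro ⟨⟨w, h⟩, k, n, hq⟩
    refine ⟨w, ?_, (tendsto_posRatFilter_iff (hf l)).1 h⟩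
    refine lt_of_lt_of_le (by positivity : 0 < 1 / ((k : ℝ) + 1)) ?_
    refine ge_of_tendsto ((hp.tendsto w).comp h) ?_
    exact eventually_posRatFilter.2 ⟨_, by positivity, hq⟩

theorem measurable_horizontal {M : ℂ → ℂ} (hM : ContinuousOn M {z | 0 < z.im}) {ε : ℝ}
    (hε : 0 < ε) : Measurable fun l : ℝ => M (l + ε * Complex.I) := by
  refine Continuous.measurable (hM.comp_continuous (by fun_prop) fun l => ?_)
  simpa using hε

theorem measurableSet_setA {M : ℂ → ℂ} (hM : ContinuousOn M {z | 0 < z.im}) :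
    MeasurableSet (setA M) :=
  measurableSet_exists_pos_tendsto (fun l => continuousOn_vertical hM l)
    (fun _ hε => measurable_horizontal hM hε) Complex.continuous_im

theorem measurableSet_setP {M : ℂ → ℂ} (hM : ContinuousOn M {z | 0 < z.im}) :
    MeasurableSet (setP M) := by
  refine MeasurableSet.union ?_ ?_
  · refine measurableSet_exists_pos_tendsto (p := id) (fun l => ?_) (fun ε hε => ?_) continuous_id
    · exact continuousOn_id.mul (Complex.continuous_im.comp_continuousOn (continuousOn_vertical hM l))
    · exact (Complex.measurable_im.comp (measurable_horizontal hM hε)).const_mul ε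
  · refine measurableSet_exists_pos_tendsto (p := id) (fun l => ?_) (fun ε hε => ?_) continuous_id
    · exact (continuousOn_id.inv₀ fun ε hε => ne_of_gt hε).mul
        (Complex.continuous_im.comp_continuousOn (continuousOn_vertical hM l))
    · exact (Complex.measurable_im.comp (measurable_horizontal hM hε)).const_mul ε⁻¹

theorem measurableSet_setS {M : ℂ → ℂ} (hM : ContinuousOn M {z | 0 < z.im}) :
    MeasurableSet (setS M) :=
  ((measurableSet_setA hM).union (measurableSet_setP hM)).compl

theorem IsHerglotz.continuousOn {M : ℂ → ℂ} (hM : IsHerglotz M) :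
    ContinuousOn M {z | 0 < z.im} := hM.1.continuousOn

/-! ### Real Möbius maps of determinant one. -/

section Mobius

variable {g : Matrix (Fin 2) (Fin 2) ℝ}

theorem mobius_denom_ne_zero (hg : g 0 0 * g 1 1 - g 0 1 * g 1 0 = 1) {z : ℂ} (hz : 0 < z.im) :
    (g 1 0 : ℂ) * z + (g 1 1 : ℂ) ≠ 0 := by
  intro h
  have h1 := congrArg Complex.im h
  have h2 := congrArg Complex.re h
  simp at h1 h2
  rcases h1 with h1 | h1
  · rw [h1] at h2 hg
    simp at h2
    rw [h2] at hg
    simp at hg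
  · exact hz.ne' h1

theorem mobius_im (hg : g 0 0 * g 1 1 - g 0 1 * g 1 0 = 1) (z : ℂ) :
    (mobius g z).im = z.im / Complex.normSq ((g 1 0 : ℂ) * z + (g 1 1 : ℂ)) := by
  rw [mobius, Complex.div_im, ← sub_div]
  congr 1
  simp
  linear_combination z.im * hg

theorem mobius_im_pos (hg : g 0 0 * g 1 1 - g 0 1 * g 1 0 = 1) {z : ℂ} (hz : 0 < z.im) :
    0 < (mobius g z).im := by
  rw [mobius_im hg]
  exact div_pos hz (Complex.normSq_pos.2 (mobius_denom_ne_zero hg hz))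

theorem mobius_mobius {h : Matrix (Fin 2) (Fin 2) ℝ} (hg : g 0 0 * g 1 1 - g 0 1 * g 1 0 = 1)
    {z : ℂ} (hz : 0 < z.im) : mobius h (mobius g z) = mobius (h * g) z := by
  have h1 := mobius_denom_ne_zero hg hz
  simp only [mobius, Matrix.mul_apply, Fin.sum_univ_two]
  rw [← mul_div_mul_right _ _ h1]
  congr 1
  · rw [add_mul, mul_assoc, div_mul_cancel₀ _ h1]
    push_cast
    ring
  · rw [add_mul, mul_assoc, div_mul_cancel₀ _ h1]
    push_cast
    ring

theorem mobius_one (z : ℂ) : mobius 1 z = z := by simp [mobius]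

theorem adjugate_det (hg : g 0 0 * g 1 1 - g 0 1 * g 1 0 = 1) :
    g.adjugate 0 0 * g.adjugate 1 1 - g.adjugate 0 1 * g.adjugate 1 0 = 1 := by
  simp [Matrix.adjugate_fin_two]
  linarith

theorem mobius_adjugate (hg : g 0 0 * g 1 1 - g 0 1 * g 1 0 = 1) {z : ℂ} (hz : 0 < z.im) :
    mobius g.adjugate (mobius g z) = z := by
  rw [mobius_mobius hg hz, Matrix.adjugate_mul, Matrix.det_fin_two, hg, one_smul, mobius_one]

theorem isHerglotz_mobius (hg : g 0 0 * g 1 1 - g 0 1 * g 1 0 = 1) {M : ℂ → ℂ}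
    (hM : IsHerglotz M) : IsHerglotz fun z => mobius g (M z) := by
  refine ⟨?_, fun z hz => mobius_im_pos hg (hM.2 z hz)⟩
  have := hM.1
  refine DifferentiableOn.div (by fun_prop) (by fun_prop) fun z hz => ?_
  exact mobius_denom_ne_zero hg (hM.2 z hz)

theorem continuousAt_mobius (hg : g 0 0 * g 1 1 - g 0 1 * g 1 0 = 1) {z : ℂ} (hz : 0 < z.im) :
    ContinuousAt (mobius g) z :=
  ContinuousAt.div (by fun_prop) (by fun_prop) (mobius_denom_ne_zero hg hz)

theorem setA_subset_mobius (hg : g 0 0 * g 1 1 - g 0 1 * g 1 0 = 1) (M : ℂ → ℂ) :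
    setA M ⊆ setA fun z => mobius g (M z) := by
  rintro l ⟨w, hw, h⟩
  exact ⟨mobius g w, mobius_im_pos hg hw, (continuousAt_mobius hg hw).tendsto.comp h⟩

/-- The easy inclusion is applied to `g` and to its inverse, the adjugate. -/
theorem setA_mobius (hg : g 0 0 * g 1 1 - g 0 1 * g 1 0 = 1) {M : ℂ → ℂ} (hM : IsHerglotz M) :
    setA (fun z => mobius g (M z)) = setA M := by
  refine (setA_subset_mobius hg M).antisymm' fun l hl => ?_
  obtain ⟨w, hw, h⟩ := setA_subset_mobius (adjugate_det hg) _ hl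
  refine ⟨w, hw, h.congr' ?_⟩
  filter_upwards [self_mem_nhdsWithin] with ε hε
  exact mobius_adjugate hg (hM.2 _ (by simpa using hε))

end Mobius

/-! ### Atoms and the set `𝒫`. -/

theorem poisson_eq_div_normSq (z : ℂ) (x : ℝ) :
    poisson z.re z.im x = z.im / Complex.normSq ((x : ℂ) - z) := by
  rw [poisson, Complex.normSq_apply]
  simp
  ring

/-- The kernels differ by `(z - z') / ((x - z)(x - z'))`; the inequality `ab ≤ (a² + b²) / 2`
separates the factors into two Poisson kernels. -/
theorem norm_sub_mul_norm_sub_inv_le {z z' : ℂ} (hz : 0 < z.im) (hz' : 0 < z'.im) (x : ℝ) :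
    ‖herglotzKernel z x - herglotzKernel z' x‖ ≤
      ‖z - z'‖ * (1 / 2) * (poisson z.re z.im x / z.im + poisson z'.re z'.im x / z'.im) := by
  have h1 := ofReal_sub_ne_zero hz x
  have h2 := ofReal_sub_ne_zero hz' x
  have h3 : herglotzKernel z x - herglotzKernel z' x =
      (z - z') / (((x : ℂ) - z) * ((x : ℂ) - z')) := by
    unfold herglotzKernel
    rw [sub_sub_sub_cancel_right, div_sub_div _ _ h1 h2]
    congr 1
    ring
  rw [h3, norm_div, norm_mul, div_eq_mul_inv, mul_inv, poisson_eq_div_normSq,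
    poisson_eq_div_normSq, Complex.normSq_eq_norm_sq, Complex.normSq_eq_norm_sq,
    div_div_cancel_left' hz.ne', div_div_cancel_left' hz'.ne', mul_assoc]
  refine mul_le_mul_of_nonneg_left ?_ (norm_nonneg _)
  rw [← inv_pow, ← inv_pow]
  nlinarith [sq_nonneg (‖(x : ℂ) - z‖⁻¹ - ‖(x : ℂ) - z'‖⁻¹)]

/-- The kernel estimate is integrated against `μ`; the linear coefficient fits in because `Im M / Im
z` is `A` plus the normalised Poisson integral. This turns control of `Im M / Im z` into a Lipschitz
bound for `M`. -/
theorem IsHerglotzRep.norm_sub_le {M : ℂ → ℂ} {A B : ℝ} {μ : Measure ℝ}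
    (h : IsHerglotzRep M A B μ) {z z' : ℂ} (hz : 0 < z.im) (hz' : 0 < z'.im) :
    ‖M z - M z'‖ ≤ ‖z - z'‖ * (1 / 2) * ((M z).im / z.im + (M z').im / z'.im) := by
  have hi := h.integrable_kernel hz
  have hi' := h.integrable_kernel hz'
  have hp := (h.integrable_poisson hz z.re).div_const z.im
  have hp' := (h.integrable_poisson hz' z'.re).div_const z'.im
  have h1 : M z - M z' = A * (z - z') + ∫ x, herglotzKernel z x - herglotzKernel z' x ∂μ := by
    rw [integral_sub hi hi', h.eq_integral hz, h.eq_integral hz']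
    ring
  have h2 : ‖∫ x, herglotzKernel z x - herglotzKernel z' x ∂μ‖ ≤
      ‖z - z'‖ * (1 / 2) * ((∫ x, poisson z.re z.im x ∂μ) / z.im +
        (∫ x, poisson z'.re z'.im x ∂μ) / z'.im) := by
    refine (norm_integral_le_of_norm_le ((hp.add hp').const_mul (‖z - z'‖ * (1 / 2)))
      (Eventually.of_forall fun x => norm_sub_mul_norm_sub_inv_le hz hz' x)).trans_eq ?_
    simp only [Pi.add_apply]
    rw [integral_const_mul, integral_add hp hp', integral_div, integral_div]
  rw [h1, h.im_eq hz, h.im_eq hz']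
  refine (norm_add_le _ _).trans ?_
  rw [norm_mul, Complex.norm_of_nonneg h.1]
  rw [add_div, add_div, mul_div_cancel_right₀ _ hz.ne', mul_div_cancel_right₀ _ hz'.ne']
  linarith

/-- A finite positive vertical derivative of the imaginary part forces a real boundary value with a
linear rate of approach. -/
theorem IsHerglotzRep.exists_tendsto_of_im_div {M : ℂ → ℂ} {A B : ℝ} {μ : Measure ℝ}
    (h : IsHerglotzRep M A B μ) {l m : ℝ}
    (hm : Tendsto (fun ε : ℝ => ε⁻¹ * (M (l + ε * Complex.I)).im) (𝓝[>] 0) (𝓝 m)) :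
    ∃ w : ℝ, Tendsto (fun ε : ℝ => M (l + ε * Complex.I)) (𝓝[>] 0) (𝓝 (w : ℂ)) ∧
      ∀ ε : ℝ, 0 < ε → ‖M (l + ε * Complex.I) - w‖ ≤
        ε * ((1 / 2) * (ε⁻¹ * (M (l + ε * Complex.I)).im + m)) := by
  have hle : ∀ ε ε' : ℝ, 0 < ε → 0 < ε' →
      ‖M (l + ε * Complex.I) - M (l + ε' * Complex.I)‖ ≤ |ε - ε'| * (1 / 2) *
        (ε⁻¹ * (M (l + ε * Complex.I)).im + ε'⁻¹ * (M (l + ε' * Complex.I)).im) := by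
    intro ε ε' hε hε'
    have := h.norm_sub_le (z := l + ε * Complex.I) (z' := l + ε' * Complex.I)
      (by simpa using hε) (by simpa using hε')
    rw [add_mul_I_im, add_mul_I_im, add_sub_add_left_eq_sub, ← sub_mul, norm_mul, Complex.norm_I,
      mul_one, ← Complex.ofReal_sub, Complex.norm_real, Real.norm_eq_abs] at this
    simpa only [div_eq_inv_mul] using this
  have hid : Tendsto (fun ε : ℝ => ε) (𝓝[>] 0) (𝓝 0) := tendsto_id.mono_left nhdsWithin_le_nhds
  obtain ⟨w, hw⟩ : ∃ w : ℂ, Tendsto (fun ε : ℝ => M (l + ε * Complex.I)) (𝓝[>] 0) (𝓝 w) := by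
    suffices Cauchy (map (fun ε : ℝ => M (l + ε * Complex.I)) (𝓝[>] 0)) from
      CompleteSpace.complete this
    rw [cauchy_map_iff, Metric.uniformity_eq_comap_nhds_zero, tendsto_comap_iff]
    refine ⟨inferInstance, ?_⟩
    have t1 := hid.comp (tendsto_fst (f := 𝓝[>] (0 : ℝ)) (g := 𝓝[>] (0 : ℝ)))
    have t2 := hid.comp (tendsto_snd (f := 𝓝[>] (0 : ℝ)) (g := 𝓝[>] (0 : ℝ)))
    have m1 := hm.comp (tendsto_fst (f := 𝓝[>] (0 : ℝ)) (g := 𝓝[>] (0 : ℝ)))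
    have m2 := hm.comp (tendsto_snd (f := 𝓝[>] (0 : ℝ)) (g := 𝓝[>] (0 : ℝ)))
    have := ((t1.sub t2).abs.mul_const (1 / 2)).mul (m1.add m2)
    simp only [sub_zero, abs_zero, zero_mul] at this
    refine squeeze_zero' (Eventually.of_forall fun _ => dist_nonneg) ?_ this
    filter_upwards [prod_mem_prod self_mem_nhdsWithin self_mem_nhdsWithin] with p hp
    simp only [Function.comp_apply]
    rw [dist_eq_norm]
    exact hle p.1 p.2 hp.1 hp.2
  have him : w.im = 0 := by
    have h1 := (Complex.continuous_im.tendsto w).comp hw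
    have h2 := hid.mul hm
    rw [zero_mul] at h2
    refine tendsto_nhds_unique (h1.congr' ?_) h2
    filter_upwards [self_mem_nhdsWithin] with ε hε
    rw [mul_inv_cancel_left₀ (ne_of_gt hε)]
    rfl
  have hwre : ((w.re : ℝ) : ℂ) = w := Complex.ext rfl him.symm
  refine ⟨w.re, by rwa [hwre], fun ε hε => ?_⟩
  rw [hwre]
  have h1 : Tendsto (fun ε' : ℝ => |ε - ε'| * (1 / 2) *
        (ε⁻¹ * (M (l + ε * Complex.I)).im + ε'⁻¹ * (M (l + ε' * Complex.I)).im)) (𝓝[>] 0)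
        (𝓝 (|ε - 0| * (1 / 2) * (ε⁻¹ * (M (l + ε * Complex.I)).im + m))) :=
    ((hid.const_sub ε).abs.mul_const _).mul (hm.const_add _)
  -- Letting `ε' → 0` in the Lipschitz bound gives the linear rate.
  rw [sub_zero, abs_of_pos hε, mul_assoc] at h1
  refine le_of_tendsto_of_tendsto (hw.const_sub _).norm h1 ?_
  filter_upwards [self_mem_nhdsWithin] with ε' hε'
  exact hle ε ε' hε hε'

section

variable {g : Matrix (Fin 2) (Fin 2) ℝ} {M : ℂ → ℂ} {A B A' B' : ℝ} {μ μ' : Measure ℝ} {l : ℝ}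

/-- Atoms lie in the point set of every transformed function. -/
theorem IsHerglotzRep.mem_setP_mobius (hg : g 0 0 * g 1 1 - g 0 1 * g 1 0 = 1)
    (h : IsHerglotzRep M A B μ) (hl : μ {l} ≠ 0) : l ∈ setP fun z => mobius g (M z) := by
  have := h.isLocallyFiniteMeasure
  have hl' : 0 < μ.real {l} := by
    rw [measureReal_def]
    exact ENNReal.toReal_pos hl isCompact_singleton.measure_ne_top
  have h1 := h.tendsto_mul_im l
  by_cases hc : g 1 0 = 0
  · have hd : g 1 1 ≠ 0 := by
      rintro hd
      simp [hc, hd] at hg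
    refine Or.inl ⟨μ.real {l} / g 1 1 ^ 2, by positivity, ?_⟩
    refine (h1.div_const _).congr fun ε => ?_
    rw [mobius_im hg, hc]
    simp [Complex.normSq_apply]
    ring
  · refine Or.inr ⟨μ.real {l} / Complex.normSq (g 1 0 * (Complex.I * μ.real {l})), ?_, ?_⟩
    · refine div_pos hl' (Complex.normSq_pos.2 ?_)
      simp [hc, hl'.ne']
    -- At an atom `ε (c M + d)` has a nonzero limit when `c ≠ 0`, and `ε⁻¹ Im g(M) = ε Im M / |ε (c
    -- M + d)|²`.
    · have h2 : Tendsto (fun ε : ℝ => (g 1 0 : ℂ) * (ε * M (l + ε * Complex.I)) + ε * g 1 1)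
          (𝓝[>] 0) (𝓝 (g 1 0 * (Complex.I * μ.real {l}) + ((0 : ℝ) : ℂ) * g 1 1)) := by
        refine ((h.tendsto_mul l).const_mul _).add ?_
        refine Tendsto.mul_const _ ?_
        exact (Complex.continuous_ofReal.tendsto 0).mono_left nhdsWithin_le_nhds
      rw [Complex.ofReal_zero, zero_mul, add_zero] at h2
      refine (h1.div ((Complex.continuous_normSq.tendsto _).comp h2) ?_).congr' ?_
      · simp [hc, hl'.ne']
      · filter_upwards [self_mem_nhdsWithin] with ε hε
        have hε0 : ε ≠ 0 := ne_of_gt hε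
        have h3 : (g 1 0 : ℂ) * (ε * M (l + ε * Complex.I)) + ε * g 1 1 =
            ε * (g 1 0 * M (l + ε * Complex.I) + g 1 1) := by ring
        rw [Pi.div_apply, Function.comp_apply, h3, mobius_im hg, Complex.normSq_mul, Complex.normSq_ofReal]
        rw [mul_div_mul_comm, div_mul_cancel_left₀ hε0]

/-- At a point of the point set, each transformed function has an atom or a vanishing imaginary
part. -/
theorem IsHerglotzRep.atom_or_tendsto_zero (hg : g 0 0 * g 1 1 - g 0 1 * g 1 0 = 1)
    (hM : IsHerglotz M) (h : IsHerglotzRep M A B μ)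
    (h' : IsHerglotzRep (fun z => mobius g (M z)) A' B' μ') (hl : l ∈ setP M) :
    μ' {l} ≠ 0 ∨
      Tendsto (fun ε : ℝ => (mobius g (M (l + ε * Complex.I))).im) (𝓝[>] 0) (𝓝 0) := by
  have hatom : μ'.real {l} ≠ 0 → μ' {l} ≠ 0 := fun h0 h1 => h0 (by simp [measureReal_def, h1])
  have hε' := h'.tendsto_mul_im l
  have hpos : ∀ ε : ℝ, 0 < ε → 0 < (M (l + ε * Complex.I)).im :=
    fun ε hε => hM.2 _ (by simpa using hε)
  rcases hl with ⟨m, hm, hlim⟩ | ⟨m, hm, hlim⟩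
  · by_cases hc : g 1 0 = 0
    · left
      apply hatom
      have hd : g 1 1 ≠ 0 := by
        rintro hd
        simp [hc, hd] at hg
      have h1 : μ'.real {l} = m / g 1 1 ^ 2 := by
        refine tendsto_nhds_unique hε' ((hlim.div_const (g 1 1 ^ 2)).congr fun ε => ?_)
        rw [mobius_im hg, hc]
        simp [Complex.normSq_apply]
        ring
      rw [h1]
      positivity
    · right
      -- From `|c M + d|² ≥ c² (Im M)²` one gets `Im g(M) ≤ 1 / (c² Im M)`, where `Im M` grows like
      -- `m / ε`.
      have h2 : Tendsto (fun ε : ℝ => ε / (g 1 0 ^ 2 * (ε * (M (l + ε * Complex.I)).im)))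
          (𝓝[>] 0) (𝓝 (0 / (g 1 0 ^ 2 * m))) :=
        (tendsto_id.mono_left nhdsWithin_le_nhds).div (hlim.const_mul _) (by positivity)
      rw [zero_div] at h2
      refine squeeze_zero' ?_ ?_ h2
      · filter_upwards [self_mem_nhdsWithin] with ε hε
        exact (mobius_im_pos hg (hpos ε hε)).le
      · filter_upwards [self_mem_nhdsWithin] with ε hε
        have hε0 : 0 < ε := hε
        have hp := hpos ε hε
        have hns : g 1 0 ^ 2 * (M (l + ε * Complex.I)).im ^ 2 ≤
            Complex.normSq ((g 1 0 : ℂ) * M (l + ε * Complex.I) + (g 1 1 : ℂ)) := by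
          rw [Complex.normSq_apply]
          simp
          nlinarith [mul_self_nonneg (g 1 0 * (M (l + ε * Complex.I)).re + g 1 1)]
        rw [mobius_im hg]
        calc _ ≤ (M (l + ε * Complex.I)).im / (g 1 0 ^ 2 * (M (l + ε * Complex.I)).im ^ 2) := by
              gcongr
          _ = _ := by field_simp
  · obtain ⟨w, hw, hrate⟩ := h.exists_tendsto_of_im_div hlim
    by_cases hcw : g 1 0 * w + g 1 1 = 0
    · left
      apply hatom
      have hc : g 1 0 ≠ 0 := by
        rintro hc
        rw [hc, zero_mul, zero_add] at hcw
        simp [hc, hcw] at hg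
      -- Here `w` is the pole of `g`, so `|c M + d| = |c| |M - w|`. The linear rate bounds `ε Im
      -- g(M)` below by a quantity tending to `1 / (c² m) > 0`.
      have h2 : Tendsto (fun ε : ℝ => (ε⁻¹ * (M (l + ε * Complex.I)).im) / (g 1 0 ^ 2 *
          ((1 / 2) * (ε⁻¹ * (M (l + ε * Complex.I)).im + m)) ^ 2)) (𝓝[>] 0)
          (𝓝 (m / (g 1 0 ^ 2 * ((1 / 2) * (m + m)) ^ 2))) :=
        hlim.div ((((hlim.add_const m).const_mul _).pow 2).const_mul _) (by positivity)
      refine (lt_of_lt_of_le (by positivity) (le_of_tendsto_of_tendsto h2 hε' ?_)).ne'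
      filter_upwards [self_mem_nhdsWithin] with ε hε
      have hε0 : 0 < ε := hε
      have hp := hpos ε hε
      have hd : (g 1 0 : ℂ) * M (l + ε * Complex.I) + (g 1 1 : ℂ) =
          g 1 0 * (M (l + ε * Complex.I) - w) := by
        have : (g 1 0 : ℂ) * w + g 1 1 = 0 := by exact_mod_cast hcw
        linear_combination this
      have hne : 0 < ‖M (l + ε * Complex.I) - w‖ := by
        rw [norm_pos_iff, sub_ne_zero]
        intro he
        rw [he, Complex.ofReal_im] at hp
        exact lt_irrefl _ hp
      rw [mobius_im hg, hd, Complex.normSq_mul, Complex.normSq_ofReal, Complex.normSq_eq_norm_sq]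
      have h3 : ‖M (l + ε * Complex.I) - w‖ ^ 2 ≤
          (ε * ((1 / 2) * (ε⁻¹ * (M (l + ε * Complex.I)).im + m))) ^ 2 := by
        have := hrate ε hε0
        gcongr
      calc _ = ε * ((M (l + ε * Complex.I)).im / (g 1 0 * g 1 0 *
          (ε * ((1 / 2) * (ε⁻¹ * (M (l + ε * Complex.I)).im + m))) ^ 2)) := by
            field_simp
        _ ≤ _ := by
            gcongr
            · exact mul_pos (mul_self_pos.2 hc) (by positivity)
            · exact mul_self_nonneg _
    · right
      -- Away from the pole the real boundary value `w` makes `Im g(M)` vanish in the limit.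
      have h1 : Tendsto (fun ε : ℝ => (g 1 0 : ℂ) * M (l + ε * Complex.I) + (g 1 1 : ℂ)) (𝓝[>] 0)
          (𝓝 ((g 1 0 : ℂ) * w + (g 1 1 : ℂ))) := (hw.const_mul _).add_const _
      have h2 := ((Complex.continuous_im.tendsto _).comp hw).div
        ((Complex.continuous_normSq.tendsto _).comp h1) (by
          rw [Ne, Complex.normSq_eq_zero]; exact_mod_cast hcw)
      rw [Complex.ofReal_im, zero_div] at h2
      refine h2.congr fun ε => ?_
      rw [mobius_im hg]
      rfl

theorem setP_congr {M' : ℂ → ℂ} (h : ∀ z : ℂ, 0 < z.im → M z = M' z) : setP M = setP M' := by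
  have h1 : ∀ l : ℝ, (fun ε : ℝ => M (l + ε * Complex.I)) =ᶠ[𝓝[>] 0]
      fun ε : ℝ => M' (l + ε * Complex.I) := fun l => by
    filter_upwards [self_mem_nhdsWithin] with ε hε
    exact h _ (by simpa using hε)
  unfold setP
  congr 1
  · ext l
    refine exists_congr fun m => and_congr_right fun _ => tendsto_congr' ?_
    filter_upwards [h1 l] with ε hε
    rw [hε]
  · ext l
    refine exists_congr fun m => and_congr_right fun _ => tendsto_congr' ?_
    filter_upwards [h1 l] with ε hε
    rw [hε]

/-- The inverse map recovers `M` from `g ∘ M`, and atoms of `g ∘ M` are sent into the point set of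
its image. -/
theorem IsHerglotzRep.mem_setP_of_atom (hg : g 0 0 * g 1 1 - g 0 1 * g 1 0 = 1)
    (hM : IsHerglotz M) (h' : IsHerglotzRep (fun z => mobius g (M z)) A' B' μ')
    (hl : μ' {l} ≠ 0) : l ∈ setP M := by
  have := h'.mem_setP_mobius (adjugate_det hg) hl
  rwa [setP_congr fun z hz => mobius_adjugate hg (hM.2 z hz)] at this

end

/-! ### The Lebesgue parts as restrictions to fixed sets. -/

section

variable {M : ℂ → ℂ} {A B : ℝ} {μ : Measure ℝ}

/-- A finite limit is incompatible with the blow-up that holds almost everywhere for the singular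
part. -/
theorem IsHerglotzRep.singularPart_null (h : IsHerglotzRep M A B μ) {s : Set ℝ}
    (hs : ∀ l ∈ s, ∃ y, Tendsto (fun ε : ℝ => (M (l + ε * Complex.I)).im) (𝓝[>] 0) (𝓝 y)) :
    μ.singularPart volume s = 0 := by
  refine measure_mono_null (fun l hl => ?_) h.ae_singularPart_tendsto
  obtain ⟨y, hy⟩ := hs l hl
  exact fun hl' => not_tendsto_nhds_of_tendsto_atTop hl' y hy

/-- Almost everywhere that the density is nonzero, the boundary value exists with imaginary part `π`
times the density, which is positive. -/
theorem IsHerglotzRep.acPart_compl_setA (hM : IsHerglotz M) (h : IsHerglotzRep M A B μ) :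
    acPart μ (setA M)ᶜ = 0 := by
  have := h.isLocallyFiniteMeasure
  rw [acPart, withDensity_apply_eq_zero (μ.measurable_rnDeriv volume)]
  refine measure_mono_null (t := {l | ¬ _}) (fun l hl hl' => ?_)
    ((h.ae_exists_tendsto hM).and (μ.rnDeriv_ne_top volume))
  obtain ⟨⟨w, hw, hlim⟩, htop⟩ := hl'
  refine hl.2 ⟨w, ?_, hlim⟩
  rw [hw]
  exact mul_pos Real.pi_pos (ENNReal.toReal_pos hl.1 htop)

theorem IsHerglotzRep.acPart_null (h : IsHerglotzRep M A B μ) {s : Set ℝ}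
    (hs : ∀ l ∈ s, Tendsto (fun ε : ℝ => (M (l + ε * Complex.I)).im) (𝓝[>] 0) (𝓝 0)) :
    acPart μ s = 0 := by
  have := h.isLocallyFiniteMeasure
  rw [acPart, withDensity_apply_eq_zero (μ.measurable_rnDeriv volume)]
  refine measure_mono_null (t := {l | ¬ _}) (fun l hl hl' => ?_)
    (h.ae_tendsto_im.and (μ.rnDeriv_ne_top volume))
  have h1 := tendsto_nhds_unique hl'.1 (hs l hl.2)
  rw [mul_eq_zero, ENNReal.toReal_eq_zero_iff] at h1
  rcases h1 with h1 | h1 | h1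
  · exact Real.pi_ne_zero h1
  · exact hl.1 h1
  · exact hl'.2 h1

theorem IsHerglotzRep.singularPart_add_acPart (h : IsHerglotzRep M A B μ) :
    μ.singularPart volume + acPart μ = μ := by
  have := h.isLocallyFiniteMeasure
  exact (μ.haveLebesgueDecomposition_add volume).symm

theorem restrict_eq_self_of_compl_null {ν : Measure ℝ} {s : Set ℝ} (h : ν sᶜ = 0) :
    ν.restrict s = ν :=
  Measure.restrict_eq_self_of_ae_mem (mem_ae_iff.2 h)

end

section

variable {g : Matrix (Fin 2) (Fin 2) ℝ} {M : ℂ → ℂ} {A B A' B' : ℝ} {μ μ' : Measure ℝ}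

/-- At these points the imaginary part tends to `0`. A finite limit excludes the singular part, and
the value `0` excludes the absolutely continuous part. -/
theorem measure_setP_diff_atoms (hg : g 0 0 * g 1 1 - g 0 1 * g 1 0 = 1) (hM : IsHerglotz M)
    (h : IsHerglotzRep M A B μ) (h' : IsHerglotzRep (fun z => mobius g (M z)) A' B' μ') :
    μ' (setP M \ {l | μ' {l} ≠ 0}) = 0 := by
  have hN : ∀ l ∈ setP M \ {l | μ' {l} ≠ 0},
      Tendsto (fun ε : ℝ => (mobius g (M (l + ε * Complex.I))).im) (𝓝[>] 0) (𝓝 0) :=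
    fun l hl => (h.atom_or_tendsto_zero hg hM h' hl.1).resolve_left hl.2
  rw [← h'.singularPart_add_acPart, Measure.add_apply, h'.singularPart_add_acPart,
    h'.singularPart_null fun l hl => ⟨0, hN l hl⟩, h'.acPart_null hN, add_zero]

theorem ppPart_mobius (hg : g 0 0 * g 1 1 - g 0 1 * g 1 0 = 1) (hM : IsHerglotz M)
    (h : IsHerglotzRep M A B μ) (h' : IsHerglotzRep (fun z => mobius g (M z)) A' B' μ') :
    ppPart μ' = μ'.restrict (setP M) := by
  refine Measure.restrict_congr_set (ae_eq_set.2 ⟨?_, measure_setP_diff_atoms hg hM h h'⟩)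
  have hsub : {l | μ' {l} ≠ 0} ⊆ setP M := fun l hl => h'.mem_setP_of_atom hg hM hl
  rw [sdiff_eq_empty.2 hsub, measure_empty]

theorem singularPart_setA (hg : g 0 0 * g 1 1 - g 0 1 * g 1 0 = 1) (hM : IsHerglotz M)
    (h' : IsHerglotzRep (fun z => mobius g (M z)) A' B' μ') :
    μ'.singularPart volume (setA M) = 0 := by
  refine h'.singularPart_null fun l hl => ?_
  rw [← setA_mobius hg hM] at hl
  obtain ⟨w, -, hw⟩ := hl
  exact ⟨w.im, (Complex.continuous_im.tendsto w).comp hw⟩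

theorem acPart_mobius (hg : g 0 0 * g 1 1 - g 0 1 * g 1 0 = 1) (hM : IsHerglotz M)
    (h' : IsHerglotzRep (fun z => mobius g (M z)) A' B' μ') :
    acPart μ' = μ'.restrict (setA M) := by
  have h1 := h'.acPart_compl_setA (isHerglotz_mobius hg hM)
  rw [setA_mobius hg hM] at h1
  nth_rw 2 [← h'.singularPart_add_acPart]
  rw [Measure.restrict_add, restrict_eq_self_of_compl_null h1,
    Measure.restrict_eq_zero.2 (singularPart_setA hg hM h'), zero_add]

/-- On `𝒮` the measure equals its singular part. The non-atoms exceed `𝒮` only by points of `𝒜`,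
null for the singular part, and by non-atoms in `𝒫`, which carry no mass. -/
theorem scPart_mobius (hg : g 0 0 * g 1 1 - g 0 1 * g 1 0 = 1) (hM : IsHerglotz M)
    (h : IsHerglotzRep M A B μ) (h' : IsHerglotzRep (fun z => mobius g (M z)) A' B' μ') :
    scPart μ' = μ'.restrict (setS M) := by
  have h1 := h'.acPart_compl_setA (isHerglotz_mobius hg hM)
  rw [setA_mobius hg hM] at h1
  have h2 : acPart μ' (setS M) = 0 :=
    measure_mono_null (compl_subset_compl.2 subset_union_left) h1
  have h3 : μ'.restrict (setS M) = (μ'.singularPart volume).restrict (setS M) := by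
    nth_rw 1 [← h'.singularPart_add_acPart]
    rw [Measure.restrict_add, Measure.restrict_eq_zero.2 h2, add_zero]
  rw [h3, scPart]
  refine Measure.restrict_congr_set (ae_eq_set.2 ⟨?_, ?_⟩)
  · refine measure_mono_null (t := setA M ∪ (setP M \ {l | μ' {l} ≠ 0})) ?_
      (measure_union_null (singularPart_setA hg hM h') ?_)
    · rintro l ⟨hl, hS⟩
      rcases not_not.1 hS with hA | hP
      · exact Or.inl hA
      · exact Or.inr ⟨hP, not_not.2 hl⟩
    · exact Measure.singularPart_le μ' volume |>.absolutelyContinuous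
        (measure_setP_diff_atoms hg hM h h')
  · rw [sdiff_eq_empty.2, measure_empty]
    intro l hl
    by_contra hl'
    exact hl (Or.inr (h'.mem_setP_of_atom hg hM hl'))

end

/-! ### The one-parameter group and the uniform bound on time averages. -/

section

variable (X : Matrix (Fin 2) (Fin 2) ℝ)

theorem hasDerivAt_exp_entry (i j : Fin 2) (t : ℝ) :
    HasDerivAt (fun t : ℝ => NormedSpace.exp (t • X) i j) ((X * NormedSpace.exp (t • X)) i j) t := by
  let _ : NormedRing (Matrix (Fin 2) (Fin 2) ℝ) := Matrix.linftyOpNormedRing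
  let _ : NormedAlgebra ℝ (Matrix (Fin 2) (Fin 2) ℝ) := Matrix.linftyOpNormedAlgebra
  have h := hasDerivAt_exp_smul_const' (𝕂 := ℝ) X t
  exact (hasDerivAt_pi.1 (hasDerivAt_pi.1 h i) j)

theorem exp_add_smul (s t : ℝ) :
    NormedSpace.exp ((s + t) • X) = NormedSpace.exp (s • X) * NormedSpace.exp (t • X) := by
  rw [add_smul]
  exact Matrix.exp_add_of_commute _ _ (((Commute.refl X).smul_left s).smul_right t)

theorem continuous_exp_entry (i j : Fin 2) : Continuous fun t : ℝ => NormedSpace.exp (t • X) i j :=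
  continuous_iff_continuousAt.2 fun t => (hasDerivAt_exp_entry X i j t).continuousAt

end

section

variable {X : Matrix (Fin 2) (Fin 2) ℝ} {α β γ : ℝ}

/-- The derivative of the determinant is the trace of `X` times the determinant, and `X` has trace
zero. -/
theorem exp_det (hX : X = sl2Elem α β γ) (t : ℝ) :
    NormedSpace.exp (t • X) 0 0 * NormedSpace.exp (t • X) 1 1 -
      NormedSpace.exp (t • X) 0 1 * NormedSpace.exp (t • X) 1 0 = 1 := by
  have hd : ∀ t : ℝ, HasDerivAt (fun t : ℝ =>
      NormedSpace.exp (t • X) 0 0 * NormedSpace.exp (t • X) 1 1 -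
      NormedSpace.exp (t • X) 0 1 * NormedSpace.exp (t • X) 1 0) 0 t := by
    intro t
    convert! ((hasDerivAt_exp_entry X 0 0 t).mul (hasDerivAt_exp_entry X 1 1 t)).sub
      ((hasDerivAt_exp_entry X 0 1 t).mul (hasDerivAt_exp_entry X 1 0 t)) using 1
    simp [hX, sl2Elem, Matrix.mul_apply, Fin.sum_univ_two]
    ring
  have := is_const_of_deriv_eq_zero (fun t => (hd t).differentiableAt)
    (fun t => (hd t).deriv) t 0
  simpa using this

theorem isHerglotz_flow (hX : X = sl2Elem α β γ) {M₀ : ℂ → ℂ} (hM : IsHerglotz M₀) (t : ℝ) :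
    IsHerglotz (flow X M₀ t) :=
  isHerglotz_mobius (exp_det hX t) hM

theorem flow_add (hX : X = sl2Elem α β γ) {M₀ : ℂ → ℂ} (hM : IsHerglotz M₀) (s t : ℝ) {z : ℂ}
    (hz : 0 < z.im) : flow X M₀ (s + t) z = flow X (flow X M₀ t) s z := by
  unfold flow
  rw [mobius_mobius (exp_det hX t) (hM.2 z hz), exp_add_smul]

theorem continuous_flow (hX : X = sl2Elem α β γ) {M₀ : ℂ → ℂ} (hM : IsHerglotz M₀) {z : ℂ}
    (hz : 0 < z.im) : Continuous fun t => flow X M₀ t z := by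
  have h := fun i j => Complex.continuous_ofReal.comp (continuous_exp_entry X i j)
  refine Continuous.div (((h 0 0).mul_const _).add (h 0 1)) (((h 1 0).mul_const _).add (h 1 1)) ?_
  exact fun t => mobius_denom_ne_zero (exp_det hX t) (hM.2 z hz)

theorem continuousOn_flow_uncurry (hX : X = sl2Elem α β γ) {M₀ : ℂ → ℂ} (hM : IsHerglotz M₀) :
    ContinuousOn (fun p : ℝ × ℂ => flow X M₀ p.1 p.2) {p | 0 < p.2.im} := by
  have h : ∀ i j, ContinuousOn (fun p : ℝ × ℂ => ((NormedSpace.exp (p.1 • X) i j : ℝ) : ℂ))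
      {p | 0 < p.2.im} := fun i j =>
    (Complex.continuous_ofReal.comp ((continuous_exp_entry X i j).comp continuous_fst)).continuousOn
  have hM' : ContinuousOn (fun p : ℝ × ℂ => M₀ p.2) {p | 0 < p.2.im} :=
    hM.continuousOn.comp continuous_snd.continuousOn fun p hp => hp
  refine ContinuousOn.div (((h 0 0).mul hM').add (h 0 1)) (((h 1 0).mul hM').add (h 1 1)) ?_
  exact fun p hp => mobius_denom_ne_zero (exp_det hX p.1) (hM.2 _ hp)

/-- On a short time interval after time zero, the lower left entry has a constant sign. -/
theorem exists_pos_exp_entry (hX : X = sl2Elem α β γ) (hγ : γ ≠ 0) :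
    ∃ δ : ℝ, 0 < δ ∧ ∀ t ∈ Ioc 0 δ, NormedSpace.exp (t • X) 1 0 ≠ 0 := by
  -- The entry vanishes at time zero with derivative `γ ≠ 0`.
  have hd := hasDerivAt_exp_entry X 1 0 0
  have hγ' : (X * NormedSpace.exp ((0 : ℝ) • X)) 1 0 ≠ 0 := by
    simpa [hX, sl2Elem] using hγ
  have h0 : NormedSpace.exp ((0 : ℝ) • X) 1 0 = 0 := by simp
  have h1 := hd.eventually_ne hγ' (c := 0)
  obtain ⟨δ, hδ, h⟩ := mem_nhdsGT_iff_exists_Ioc_subset.1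
    (nhdsWithin_mono 0 (fun t ht => ne_of_gt ht) h1)
  exact ⟨δ, hδ, fun t ht => h ht⟩

/-- The flow has a uniformly bounded imaginary part on average over short time intervals. -/
theorem integral_flow_im_le (hX : X = sl2Elem α β γ) (hγ : γ ≠ 0) {δ : ℝ} (hδ : 0 < δ)
    (hc : ∀ t ∈ Ioc 0 δ, NormedSpace.exp (t • X) 1 0 ≠ 0) {w : ℂ} (hw : 0 < w.im) :
    ∫ t in 0..δ, (mobius (NormedSpace.exp (t • X)) w).im ≤ Real.pi / |γ| := by
  set D : ℝ → ℂ := fun t => (NormedSpace.exp (t • X) 1 0 : ℂ) * w + (NormedSpace.exp (t • X) 1 1 : ℂ)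
    with hD
  -- `D 0 = 1`, and afterwards `Im D t = c_t Im w ≠ 0`; the principal logarithm is thus
  -- differentiable along the whole path.
  have hslit : ∀ t ∈ Icc 0 δ, D t ∈ Complex.slitPlane := by
    intro t ht
    rcases ht.1.eq_or_lt with rfl | h0
    · simp [hD]
    · right
      simp [hD]
      exact ⟨hc t ⟨h0, ht.2⟩, hw.ne'⟩
  have hderiv : ∀ t ∈ uIcc 0 δ, HasDerivAt (fun t => (Complex.log (D t)).im)
      (γ * (mobius (NormedSpace.exp (t • X)) w).im) t := by
    intro t ht
    rw [uIcc_of_le hδ.le] at ht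
    have h1 : HasDerivAt D (((X * NormedSpace.exp (t • X)) 1 0 : ℝ) * w +
        ((X * NormedSpace.exp (t • X)) 1 1 : ℝ)) t :=
      ((hasDerivAt_exp_entry X 1 0 t).ofReal_comp.mul_const w).add
        (hasDerivAt_exp_entry X 1 1 t).ofReal_comp
    have h2 := Complex.imCLM.hasFDerivAt.comp_hasDerivAt t (h1.clog_real (hslit t ht))
    convert! h2 using 1
    have h3 : D t ≠ 0 := Complex.slitPlane_ne_zero (hslit t ht)
    have h4 : (((X * NormedSpace.exp (t • X)) 1 0 : ℝ) * w +
        ((X * NormedSpace.exp (t • X)) 1 1 : ℝ)) / D t =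
        γ * mobius (NormedSpace.exp (t • X)) w - β := by
      rw [mobius, ← mul_div_assoc, div_sub' (h3), div_left_inj' h3]
      simp [hX, sl2Elem, Matrix.mul_apply, Fin.sum_univ_two, hD]
      ring
    rw [h4]
    simp
  have hcont : Continuous fun t : ℝ => (mobius (NormedSpace.exp (t • X)) w).im := by
    have h := fun i j => Complex.continuous_ofReal.comp (continuous_exp_entry X i j)
    refine Complex.continuous_im.comp (Continuous.div (((h 0 0).mul_const _).add (h 0 1))
      (((h 1 0).mul_const _).add (h 1 1)) ?_)
    exact fun t => mobius_denom_ne_zero (exp_det hX t) hw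
  have h5 := intervalIntegral.integral_eq_sub_of_hasDerivAt hderiv
    ((hcont.const_mul γ).intervalIntegrable _ _)
  rw [intervalIntegral.integral_const_mul] at h5
  -- The initial argument is zero, so only the final one enters, and it is at most `π` in absolute
  -- value.
  have h6 : D 0 = 1 := by simp [hD]
  rw [h6, Complex.log_one, Complex.zero_im, sub_zero, Complex.log_im] at h5
  rw [le_div_iff₀ (abs_pos.2 hγ)]
  calc _ ≤ |(∫ t in 0..δ, (mobius (NormedSpace.exp (t • X)) w).im) * γ| := by
        rw [abs_mul]
        gcongr
        exact le_abs_self _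
    _ = |Complex.arg (D δ)| := by rw [mul_comm, h5]
    _ ≤ _ := Complex.abs_arg_le_pi _

/-- The group law moves the starting time to zero by replacing `M₀` with `M_s`; the bound does not
see which half-plane point it starts from. -/
theorem exists_integral_flow_im_le (hX : X = sl2Elem α β γ) (hγ : γ ≠ 0) :
    ∃ δ : ℝ, 0 < δ ∧ ∀ (M₀ : ℂ → ℂ), IsHerglotz M₀ → ∀ (s : ℝ) (z : ℂ), 0 < z.im →
      ∫ t in s..s + δ, (flow X M₀ t z).im ≤ Real.pi / |γ| := by
  obtain ⟨δ, hδ, hc⟩ := exists_pos_exp_entry hX hγ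
  refine ⟨δ, hδ, fun M₀ hM s z hz => ?_⟩
  have h1 := integral_flow_im_le hX hγ hδ hc ((isHerglotz_flow hX hM s).2 z hz)
  have h2 : ∫ t in s..s + δ, (flow X M₀ t z).im = ∫ t in 0..δ, (flow X M₀ (t + s) z).im := by
    rw [intervalIntegral.integral_comp_add_right (fun t => (flow X M₀ t z).im), zero_add, add_comm]
  rw [h2]
  simp only [flow_add hX hM _ s hz]
  exact h1

end

/-! ### Time integrals of families of measures. -/

theorem timeInterval_coe (s₁ s₂ : ℝ) : timeInterval s₁ s₂ = Ioo s₁ s₂ := by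
  ext t; simp [timeInterval]

theorem timeInterval_mono {t₁ t₂ s₁ s₂ : EReal} (h₁ : t₁ ≤ s₁) (h₂ : s₂ ≤ t₂) :
    timeInterval s₁ s₂ ⊆ timeInterval t₁ t₂ :=
  fun _ ht => ⟨h₁.trans_lt ht.1, ht.2.trans_le h₂⟩

theorem ae_of_forall_ae_Ioo {δ : ℝ} (hδ : 0 < δ) {p : ℝ → Prop}
    (h : ∀ s : ℝ, ∀ᵐ t ∂(volume.restrict (Ioo s (s + δ))), p t) : ∀ᵐ t : ℝ, p t := by
  have h1 : ⋃ n : ℤ, Ioc (n • δ) ((n + 1) • δ) = univ := iUnion_Ioc_zsmul hδ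
  rw [← Measure.restrict_univ (μ := (volume : Measure ℝ)), ← h1, ae_restrict_iUnion_iff]
  intro n
  rw [add_smul, one_smul, ← restrict_Ioo_eq_restrict_Ioc]
  exact h _

section

variable {κ : ℝ → Measure ℝ}

theorem timeIntegral_apply (hκ : Measurable κ) (t₁ t₂ : EReal) {E : Set ℝ} (hE : MeasurableSet E) :
    timeIntegral κ t₁ t₂ E = ∫⁻ t in timeInterval t₁ t₂, κ t E :=
  Measure.bind_apply hE hκ.aemeasurable

theorem lintegral_timeIntegral (hκ : Measurable κ) (t₁ t₂ : EReal) {f : ℝ → ENNReal}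
    (hf : Measurable f) :
    ∫⁻ x, f x ∂(timeIntegral κ t₁ t₂) = ∫⁻ t in timeInterval t₁ t₂, ∫⁻ x, f x ∂(κ t) :=
  Measure.lintegral_bind hκ.aemeasurable hf.aemeasurable

theorem integral_timeIntegral (hκ : Measurable κ) (t₁ t₂ : EReal) {f : ℝ → ℂ}
    (hf : Integrable f (timeIntegral κ t₁ t₂)) :
    ∫ x, f x ∂(timeIntegral κ t₁ t₂) = ∫ t in timeInterval t₁ t₂, ∫ x, f x ∂(κ t) := by
  let k : ProbabilityTheory.Kernel ℝ ℝ := ⟨κ, hκ⟩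
  have h := ProbabilityTheory.Kernel.integral_comp (η := k)
    (κ := ProbabilityTheory.Kernel.const Unit (volume.restrict (timeInterval t₁ t₂))) (a := ())
    (f := f) (by rwa [← Measure.comp_eq_comp_const_apply])
  rw [← Measure.comp_eq_comp_const_apply] at h
  exact h

theorem timeIntegral_mono (hκ : Measurable κ) {t₁ t₂ s₁ s₂ : EReal} (h₁ : t₁ ≤ s₁) (h₂ : s₂ ≤ t₂) :
    timeIntegral κ s₁ s₂ ≤ timeIntegral κ t₁ t₂ := by
  refine Measure.le_iff.2 fun E hE => ?_
  rw [timeIntegral_apply hκ _ _ hE, timeIntegral_apply hκ _ _ hE]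
  exact lintegral_mono_set (timeInterval_mono h₁ h₂)

/-- The time interval is the union of its rational subintervals. They form a countable directed
family, to which monotone convergence applies. -/
theorem timeIntegral_eq_iSup (hκ : Measurable κ) (t₁ t₂ : EReal) {E : Set ℝ}
    (hE : MeasurableSet E) :
    timeIntegral κ t₁ t₂ E =
      ⨆ (s₁ : ℝ) (s₂ : ℝ) (_ : t₁ ≤ s₁ ∧ s₁ < s₂ ∧ (s₂ : EReal) ≤ t₂),
        timeIntegral κ s₁ s₂ E := by
  refine le_antisymm ?_ (iSup_le fun s₁ => iSup_le fun s₂ => iSup_le fun h =>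
    timeIntegral_mono hκ h.1 h.2.2 E)
  let ι := {p : ℚ × ℚ // t₁ < ((p.1 : ℝ) : EReal) ∧ (p.1 : ℝ) < (p.2 : ℝ) ∧
    ((p.2 : ℝ) : EReal) < t₂}
  have hU : timeInterval t₁ t₂ = ⋃ p : ι, Ioo (p.1.1 : ℝ) (p.1.2 : ℝ) := by
    ext t
    simp only [mem_iUnion]
    constructor
    · rintro ⟨h1, h2⟩
      obtain ⟨p, hp1, hp2⟩ := EReal.lt_iff_exists_rat_btwn.1 h1
      obtain ⟨q, hq1, hq2⟩ := EReal.lt_iff_exists_rat_btwn.1 h2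
      have hp2' : (p : ℝ) < t := by exact_mod_cast hp2
      have hq1' : t < (q : ℝ) := by exact_mod_cast hq1
      exact ⟨⟨(p, q), hp1, hp2'.trans hq1', hq2⟩, hp2', hq1'⟩
    · rintro ⟨p, hp1, hp2⟩
      exact ⟨p.2.1.trans (EReal.coe_lt_coe_iff.2 hp1), (EReal.coe_lt_coe_iff.2 hp2).trans p.2.2.2⟩
  have hdir : Directed (· ⊆ ·) fun p : ι => Ioo (p.1.1 : ℝ) (p.1.2 : ℝ) := by
    intro p q
    refine ⟨⟨(min p.1.1 q.1.1, max p.1.2 q.1.2), ?_, ?_, ?_⟩, ?_, ?_⟩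
    · rcases min_choice p.1.1 q.1.1 with h | h <;> rw [h]
      exacts [p.2.1, q.2.1]
    · have h1 : (p.1.1 : ℝ) < p.1.2 := p.2.2.1
      have h2 : p.1.1 < p.1.2 := by exact_mod_cast h1
      exact_mod_cast (min_le_left _ _).trans_lt (h2.trans_le (le_max_left _ _))
    · rcases max_choice p.1.2 q.1.2 with h | h <;> rw [h]
      exacts [p.2.2.2, q.2.2.2]
    · exact Ioo_subset_Ioo (by exact_mod_cast min_le_left _ _) (by exact_mod_cast le_max_left _ _)
    · exact Ioo_subset_Ioo (by exact_mod_cast min_le_right _ _)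
        (by exact_mod_cast le_max_right _ _)
  rw [timeIntegral_apply hκ _ _ hE, hU, setLIntegral_iUnion_of_directed _ hdir]
  refine iSup_le fun p => ?_
  refine le_iSup_of_le (p.1.1 : ℝ) (le_iSup_of_le (p.1.2 : ℝ) (le_iSup_of_le
    ⟨p.2.1.le, p.2.2.1, p.2.2.2.le⟩ ?_))
  rw [timeIntegral_apply hκ _ _ hE, timeInterval_coe]

end

theorem measurable_restrict_family {κ : ℝ → Measure ℝ} (hκ : Measurable κ) {s : Set ℝ}
    (hs : MeasurableSet s) : Measurable fun t => (κ t).restrict s := by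
  refine Measure.measurable_of_measurable_coe _ fun E hE => ?_
  simp only [Measure.restrict_apply hE]
  exact (Measure.measurable_coe (hE.inter hs)).comp hκ

/-! ### The measures `μ_t` and their averages. -/

/-- The measure in the representation of the transformed function. -/
def flowMeasure (X : Matrix (Fin 2) (Fin 2) ℝ) (M₀ : ℂ → ℂ) (t : ℝ) : Measure ℝ :=
  herglotzMeasure (flow X M₀ t)

section

variable {X : Matrix (Fin 2) (Fin 2) ℝ} {α β γ : ℝ} {M₀ : ℂ → ℂ}

theorem exists_rep_flow (hX : X = sl2Elem α β γ) (hM : IsHerglotz M₀) (t : ℝ) :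
    ∃ A B : ℝ, IsHerglotzRep (flow X M₀ t) A B (flowMeasure X M₀ t) := by
  have h := isHerglotz_flow hX hM t
  obtain ⟨A, B, μ, hμ⟩ := exists_isHerglotzRep h.1 fun z hz => (h.2 z hz).le
  exact ⟨A, B, by rwa [flowMeasure, hμ.herglotzMeasure_eq]⟩

/-- Measurability comes from the growth rate along the imaginary axis: the slope is a pointwise
limit of functions continuous in `t`. -/
theorem exists_slope_flow (hX : X = sl2Elem α β γ) (hM : IsHerglotz M₀) :
    ∃ A : ℝ → ℝ, Measurable A ∧ ∀ t,
      IsHerglotzRep (flow X M₀ t) (A t) (flow X M₀ t Complex.I).re (flowMeasure X M₀ t) := by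
  choose A B h using exists_rep_flow hX hM
  refine ⟨A, ?_, fun t => (h t).eq_re ▸ h t⟩
  refine measurable_of_tendsto_metrizable (fun n => ?_)
    (tendsto_pi_nhds.2 fun t => (h t).tendsto_im_div)
  refine (Continuous.measurable ?_).div_const _
  refine Complex.continuous_im.comp (continuous_flow hX hM ?_)
  rw [Complex.im_ofReal_mul, Complex.I_im, mul_one]
  positivity

/-- Stieltjes inversion makes the mass of a half-open interval a limit of measurable functions of
`t`. A π-system argument on bounded truncations, where the measures are finite, extends this to all
Borel sets. -/
theorem measurable_flowMeasure (hX : X = sl2Elem α β γ) (hM : IsHerglotz M₀) :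
    Measurable (flowMeasure X M₀) := by
  choose A B h using exists_rep_flow hX hM
  have hIoc : ∀ a b : ℝ, Measurable fun t => flowMeasure X M₀ t (Ioc a b) := by
    intro a b
    rcases le_or_gt b a with hab | hab
    · simp [Ioc_eq_empty hab.not_gt]
    have h1 : Measurable fun t => ENNReal.ofReal Real.pi * flowMeasure X M₀ t (Ioc a b) := by
      refine ENNReal.measurable_of_tendsto (fun n => ?_)
        (tendsto_pi_nhds.2 fun t => (h t).tendsto_lintegral_im hab.le)
      refine Measurable.lintegral_prod_right' (f := fun p : ℝ × ℝ => ENNReal.ofReal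
        (flow X M₀ p.1 (p.2 + (1 / ((n : ℝ) + 1) ^ 2 : ℝ) * Complex.I)).im) ?_
      refine ENNReal.measurable_ofReal.comp (Continuous.measurable
        (Complex.continuous_im.comp ?_))
      refine (continuousOn_flow_uncurry hX hM).comp_continuous
        (f := fun p : ℝ × ℝ => (p.1, (p.2 : ℂ) + (1 / ((n : ℝ) + 1) ^ 2 : ℝ) * Complex.I))
        (by fun_prop) fun p => ?_
      change 0 < ((p.2 : ℂ) + (1 / ((n : ℝ) + 1) ^ 2 : ℝ) * Complex.I).im
      rw [add_mul_I_im]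
      positivity
    have h2 : (fun t => flowMeasure X M₀ t (Ioc a b)) = fun t => (ENNReal.ofReal Real.pi)⁻¹ *
        (ENNReal.ofReal Real.pi * flowMeasure X M₀ t (Ioc a b)) := by
      funext t
      rw [← mul_assoc, ENNReal.inv_mul_cancel (by simpa using Real.pi_pos) ENNReal.ofReal_ne_top,
        one_mul]
    rw [h2]
    exact h1.const_mul _
  have hloc : ∀ t, IsLocallyFiniteMeasure (flowMeasure X M₀ t) :=
    fun t => (h t).isLocallyFiniteMeasure
  have hfin : ∀ (n : ℕ) (t : ℝ),
      IsFiniteMeasure ((flowMeasure X M₀ t).restrict (Ioc (-(n : ℝ)) n)) :=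
    fun n t => ⟨by rw [Measure.restrict_apply_univ]; exact measure_Ioc_lt_top⟩
  have hres : ∀ n : ℕ, Measurable fun t => (flowMeasure X M₀ t).restrict (Ioc (-(n : ℝ)) n) := by
    intro n
    refine Measurable.measure_of_isPiSystem
      (BorelSpace.measurable_eq.trans (borel_eq_generateFrom_Ioc ℝ)) (isPiSystem_Ioc id id) ?_ ?_
    · rintro _ ⟨a, b, -, rfl⟩
      simp only [Measure.restrict_apply measurableSet_Ioc, Ioc_inter_Ioc]
      exact hIoc _ _
    · simp only [Measure.restrict_apply_univ]
      exact hIoc _ _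
  refine Measure.measurable_of_measurable_coe _ fun s hs => ?_
  have hU : ⋃ n : ℕ, (s ∩ Ioc (-(n : ℝ)) n) = s := by
    rw [← inter_iUnion, inter_eq_left]
    intro x _
    obtain ⟨n, hn⟩ := exists_nat_gt |x|
    exact mem_iUnion.2 ⟨n, (abs_lt.1 hn).1, (abs_lt.1 hn).2.le⟩
  have hmono : Monotone fun n : ℕ => s ∩ Ioc (-(n : ℝ)) n := fun m n hmn => by
    have : (m : ℝ) ≤ n := by exact_mod_cast hmn
    exact inter_subset_inter_right _ (Ioc_subset_Ioc (by linarith) this)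
  have heq : (fun t => flowMeasure X M₀ t s) =
      fun t => ⨆ n : ℕ, (flowMeasure X M₀ t).restrict (Ioc (-(n : ℝ)) n) s := by
    funext t
    simp only [Measure.restrict_apply hs]
    rw [← hmono.measure_iUnion, hU]
  rw [heq]
  exact Measurable.iSup fun n => (Measure.measurable_coe hs).comp (hres n)

/-- Almost every transformed function has no linear term. -/
theorem ae_slope_eq_zero (hX : X = sl2Elem α β γ) (hγ : γ ≠ 0) (hM : IsHerglotz M₀) {A : ℝ → ℝ}
    (hA : Measurable A) (h : ∀ t, ∃ B μ, IsHerglotzRep (flow X M₀ t) (A t) B μ) :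
    ∀ᵐ t, A t = 0 := by
  obtain ⟨δ, hδ, hint⟩ := exists_integral_flow_im_le hX hγ
  refine ae_of_forall_ae_Ioo hδ fun s => ?_
  have hA0 : ∀ t, 0 ≤ A t := fun t => by
    obtain ⟨B, μ, hr⟩ := h t
    exact hr.1
  -- `n A_t ≤ Im M_t(i n)`, whose time integral is bounded independently of `n`.
  have hbound : ∀ n : ℕ, (n : ENNReal) * ∫⁻ t in Ioo s (s + δ), ENNReal.ofReal (A t) ≤
      ENNReal.ofReal (Real.pi / |γ|) := by
    intro n
    rcases Nat.eq_zero_or_pos n with rfl | hn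
    · simp
    have hn' : (0 : ℝ) < n := by exact_mod_cast hn
    have hz : 0 < (((n : ℝ) : ℂ) * Complex.I).im := by simpa using hn'
    have hcont : Continuous fun t => (flow X M₀ t (((n : ℝ) : ℂ) * Complex.I)).im :=
      Complex.continuous_im.comp (continuous_flow hX hM hz)
    have h1 := hint M₀ hM s _ hz
    rw [intervalIntegral.integral_of_le (by linarith), integral_Ioc_eq_integral_Ioo] at h1
    rw [← ENNReal.ofReal_natCast, ← lintegral_const_mul' _ _ ENNReal.ofReal_ne_top]
    refine le_trans (lintegral_mono fun t => ?_) (le_trans (ofReal_integral_eq_lintegral_ofReal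
      (hcont.integrableOn_Icc.mono_set Ioo_subset_Icc_self)
      (Eventually.of_forall fun t => ((isHerglotz_flow hX hM t).2 _ hz).le)).ge
      (ENNReal.ofReal_le_ofReal h1))
    obtain ⟨B, μ, hr⟩ := h t
    rw [← ENNReal.ofReal_mul hn'.le]
    refine ENNReal.ofReal_le_ofReal ?_
    have := hr.mul_im_le hz
    rw [Complex.im_ofReal_mul, Complex.I_im, mul_one] at this
    linarith
  have hzero : ∫⁻ t in Ioo s (s + δ), ENNReal.ofReal (A t) = 0 := by
    by_contra hne
    obtain ⟨n, hn⟩ := ENNReal.exists_nat_mul_gt hne (ENNReal.ofReal_ne_top (r := Real.pi / |γ|))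
    exact absurd (hbound n) (not_le.2 hn)
  rw [lintegral_eq_zero_iff hA.ennreal_ofReal] at hzero
  filter_upwards [hzero] with t ht
  exact le_antisymm (ENNReal.ofReal_eq_zero.1 ht) (hA0 t)

/-- Makes the kernel integrability available for a measure known only to satisfy the weight
condition. -/
theorem isHerglotzRep_zero {ν : Measure ℝ}
    (hν : ∫⁻ x : ℝ, ENNReal.ofReal (1 / (1 + x ^ 2)) ∂ν < ⊤) :
    IsHerglotzRep (fun z => ∫ x, herglotzKernel z x ∂ν) 0 0 ν :=
  ⟨le_rfl, hν, fun z _ => by simp [herglotzKernel]⟩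

/-- The averaged function is represented by the averaged measure, without linear term. -/
theorem isHerglotzRep_intFlow (hX : X = sl2Elem α β γ) (hγ : γ ≠ 0) (hM : IsHerglotz M₀)
    {s₁ s₂ : ℝ} (hs : s₁ ≤ s₂) :
    IsHerglotzRep (intFlow X M₀ s₁ s₂) 0 (∫ t in s₁..s₂, (flow X M₀ t Complex.I).re)
      (timeIntegral (flowMeasure X M₀) s₁ s₂) := by
  obtain ⟨A, hA, hrep⟩ := exists_slope_flow hX hM
  have hA0 := ae_slope_eq_zero hX hγ hM hA fun t => ⟨_, _, hrep t⟩
  have hμ := measurable_flowMeasure hX hM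
  have hI : 0 < Complex.I.im := by simp
  have hw : ∫⁻ x : ℝ, ENNReal.ofReal (1 / (1 + x ^ 2)) ∂(timeIntegral (flowMeasure X M₀) s₁ s₂)
      < ⊤ := by
    rw [lintegral_timeIntegral hμ _ _ (by fun_prop), timeInterval_coe]
    refine (lintegral_mono fun t => (hrep t).lintegral_weight_le).trans_lt ?_
    exact ((Complex.continuous_im.comp
      (continuous_flow hX hM hI)).integrableOn_Icc.mono_set Ioo_subset_Icc_self).lintegral_lt_top
  refine ⟨le_rfl, hw, fun z hz => ?_⟩
  have hre : Continuous fun t => (flow X M₀ t Complex.I).re :=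
    Complex.continuous_re.comp (continuous_flow hX hM hI)
  change _ = _ + ∫ x, herglotzKernel z x ∂_
  rw [integral_timeIntegral hμ _ _ ((isHerglotzRep_zero hw).integrable_kernel hz), timeInterval_coe,
    intFlow, intervalIntegral.integral_of_le hs, intervalIntegral.integral_of_le hs,
    integral_Ioc_eq_integral_Ioo, integral_Ioc_eq_integral_Ioo]
  -- The linear term drops out for almost every `t`, so Fubini leaves the time integral of `M_t(z) -
  -- Re M_t(i)`.
  have hk : ∀ᵐ t, ∫ x, herglotzKernel z x ∂(flowMeasure X M₀ t) =
      flow X M₀ t z - ((flow X M₀ t Complex.I).re : ℂ) := by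
    filter_upwards [hA0] with t ht
    rw [(hrep t).eq_integral hz, ht]
    simp
  rw [integral_congr_ae (ae_restrict_of_ae hk), integral_sub, integral_complex_ofReal]
  · simp
  · exact (continuous_flow hX hM hz).integrableOn_Icc.mono_set Ioo_subset_Icc_self
  · exact (Complex.continuous_ofReal.comp hre).integrableOn_Icc.mono_set Ioo_subset_Icc_self

/-- By uniqueness, each measure in the supremum is a time integral over a finite interval. Their
setwise supremum is already the time integral over the whole interval. -/
theorem avgMeasure_eq_timeIntegral (hX : X = sl2Elem α β γ) (hγ : γ ≠ 0) (hM : IsHerglotz M₀)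
    (t₁ t₂ : EReal) :
    avgMeasure X M₀ t₁ t₂ = timeIntegral (flowMeasure X M₀) t₁ t₂ := by
  have hμ := measurable_flowMeasure hX hM
  have heq : ∀ s₁ s₂ : ℝ, s₁ < s₂ → herglotzMeasure (intFlow X M₀ s₁ s₂) =
      timeIntegral (flowMeasure X M₀) s₁ s₂ := fun s₁ s₂ h =>
    (isHerglotzRep_intFlow hX hγ hM h.le).herglotzMeasure_eq
  refine le_antisymm ?_ (Measure.le_iff.2 fun E hE => ?_)
  · refine iSup_le fun s₁ => iSup_le fun s₂ => iSup_le fun h => ?_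
    rw [heq s₁ s₂ h.2.1]
    exact timeIntegral_mono hμ h.1 h.2.2
  · rw [timeIntegral_eq_iSup hμ _ _ hE]
    refine iSup_le fun s₁ => iSup_le fun s₂ => iSup_le fun h => ?_
    rw [← heq s₁ s₂ h.2.1]
    have hle : herglotzMeasure (intFlow X M₀ s₁ s₂) ≤ avgMeasure X M₀ t₁ t₂ :=
      le_iSup_of_le s₁ (le_iSup_of_le s₂ (le_iSup_of_le h le_rfl))
    exact hle E

/-- A Lebesgue null set is a null set for almost every transformed measure. -/
theorem ae_flowMeasure_eq_zero (hX : X = sl2Elem α β γ) (hγ : γ ≠ 0) (hM : IsHerglotz M₀)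
    {E : Set ℝ} (hE : MeasurableSet E) (hE0 : volume E = 0) :
    ∀ᵐ t, flowMeasure X M₀ t E = 0 := by
  have hμ := measurable_flowMeasure hX hM
  obtain ⟨δ, hδ, hint⟩ := exists_integral_flow_im_le hX hγ
  refine ae_of_forall_ae_Ioo hδ fun s => ?_
  have hr := isHerglotzRep_intFlow hX hγ hM (s₁ := s) (s₂ := s + δ) (by linarith)
  set ν := timeIntegral (flowMeasure X M₀) s (s + δ : ℝ) with hν
  -- The averaged function has imaginary part at most `π / |γ|`, so the blow-up required almost
  -- everywhere for the singular part never happens.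
  have hsing : ν.singularPart volume univ = 0 := by
    suffices h : ∀ᵐ _ ∂(ν.singularPart volume), False by simpa using h
    filter_upwards [hr.ae_singularPart_tendsto] with l hl
    obtain ⟨ε, hε, hε0⟩ :=
      ((hl.eventually_gt_atTop (Real.pi / |γ|)).and self_mem_nhdsWithin).exists
    have hz : 0 < ((l : ℂ) + ε * Complex.I).im := by simpa using hε0
    refine absurd (hint M₀ hM s _ hz) (not_le.2 ?_)
    have := Complex.imCLM.intervalIntegral_comp_comm
      ((continuous_flow hX hM hz).intervalIntegrable (μ := volume) s (s + δ))
    simp only [Complex.imCLM_apply] at this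
    rw [this]
    exact hε
  have h0 : ν E = 0 := by
    rw [← hr.singularPart_add_acPart, Measure.add_apply]
    rw [measure_mono_null (subset_univ E) hsing, zero_add]
    exact withDensity_absolutelyContinuous _ _ hE0
  have hm : Measurable fun t => flowMeasure X M₀ t E := (Measure.measurable_coe hE).comp hμ
  rw [hν, timeIntegral_apply hμ _ _ hE, timeInterval_coe, lintegral_eq_zero_iff hm] at h0
  exact h0

theorem timeIntegral_restrict_absolutelyContinuous (hX : X = sl2Elem α β γ) (hγ : γ ≠ 0)
    (hM : IsHerglotz M₀) {κ : ℝ → Measure ℝ} (hκ : Measurable κ)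
    (hle : ∀ t, κ t ≤ flowMeasure X M₀ t) (t₁ t₂ : EReal) : timeIntegral κ t₁ t₂ ≪ volume := by
  refine Measure.AbsolutelyContinuous.mk fun E hE hE0 => ?_
  have hm : Measurable fun t => κ t E := (Measure.measurable_coe hE).comp hκ
  rw [timeIntegral_apply hκ _ _ hE, lintegral_eq_zero_iff hm]
  refine ae_restrict_of_ae ?_
  filter_upwards [ae_flowMeasure_eq_zero hX hγ hM hE hE0] with t ht
  exact le_antisymm ((hle t E).trans_eq ht) zero_le

/-- The averaged Poisson integral formula. -/
theorem lintegral_flow_im (hX : X = sl2Elem α β γ) (hγ : γ ≠ 0) (hM : IsHerglotz M₀)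
    (t₁ t₂ : EReal) {z : ℂ} (hz : 0 < z.im) :
    ∫⁻ t in timeInterval t₁ t₂, ENNReal.ofReal (flow X M₀ t z).im =
      ∫⁻ x : ℝ, ENNReal.ofReal (1 / ((x : ℂ) - z)).im
        ∂(timeIntegral (flowMeasure X M₀) t₁ t₂) := by
  obtain ⟨A, hA, hrep⟩ := exists_slope_flow hX hM
  have hA0 := ae_slope_eq_zero hX hγ hM hA fun t => ⟨_, _, hrep t⟩
  have hm : Measurable fun x : ℝ => ENNReal.ofReal (1 / ((x : ℂ) - z)).im := by fun_prop
  rw [lintegral_timeIntegral (measurable_flowMeasure hX hM) _ _ hm]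
  refine lintegral_congr_ae (ae_restrict_of_ae ?_)
  filter_upwards [hA0] with t ht
  rw [(hrep t).ofReal_im hz, ht]
  simp [im_one_div_ofReal_sub, -one_div]

/-- The sets do not depend on `t`, so measurability and averages of the three parts reduce to those
of `μ_t`. -/
theorem parts_flowMeasure (hX : X = sl2Elem α β γ) (hM : IsHerglotz M₀) (t : ℝ) :
    acPart (flowMeasure X M₀ t) = (flowMeasure X M₀ t).restrict (setA M₀) ∧
      scPart (flowMeasure X M₀ t) = (flowMeasure X M₀ t).restrict (setS M₀) ∧
      ppPart (flowMeasure X M₀ t) = (flowMeasure X M₀ t).restrict (setP M₀) := by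
  obtain ⟨A, B, μ, h⟩ := exists_isHerglotzRep hM.1 fun z hz => (hM.2 z hz).le
  obtain ⟨A', B', h'⟩ := exists_rep_flow hX hM t
  have hg := exp_det hX t
  exact ⟨acPart_mobius hg hM h', scPart_mobius hg hM h h', ppPart_mobius hg hM h h'⟩

/-- Averaging the restrictions of the transformed measures to a fixed set. -/
theorem average_restrict_flowMeasure (hX : X = sl2Elem α β γ) (hγ : γ ≠ 0) (hM : IsHerglotz M₀)
    {s : Set ℝ} (hs : MeasurableSet s) (t₁ t₂ : EReal) {Δ : Set ℝ} (hΔ : MeasurableSet Δ) :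
    Measurable (fun t => (flowMeasure X M₀ t).restrict s Δ) ∧
      ∫⁻ t in timeInterval t₁ t₂, (flowMeasure X M₀ t).restrict s Δ =
        avgMeasure X M₀ t₁ t₂ (Δ ∩ s) := by
  have hμ := measurable_flowMeasure hX hM
  refine ⟨(Measure.measurable_coe hΔ).comp (measurable_restrict_family hμ hs), ?_⟩
  simp only [Measure.restrict_apply hΔ]
  rw [avgMeasure_eq_timeIntegral hX hγ hM, timeIntegral_apply hμ _ _ (hΔ.inter hs)]

theorem volume_restrict_flowMeasure_ne_zero (hX : X = sl2Elem α β γ) (hγ : γ ≠ 0)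
    (hM : IsHerglotz M₀) {s : Set ℝ} (hs : MeasurableSet s) (h0 : volume s = 0) :
    volume {t : ℝ | (flowMeasure X M₀ t).restrict s univ ≠ 0} = 0 := by
  simp only [Measure.restrict_apply_univ]
  exact ae_iff.1 (ae_flowMeasure_eq_zero hX hγ hM hs h0)

end

end

end SpecAvg

/-! ### Assembly of the theorem. -/

open SpecAvg

theorem mainTheorem1 (α β γ : ℝ) (hγ : γ ≠ 0) (M₀ : ℂ → ℂ) (hM₀ : IsHerglotz M₀)
    (X : Matrix (Fin 2) (Fin 2) ℝ) (hX : X = sl2Elem α β γ)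
    (μ : ℝ → Measure ℝ) (hμ : μ = fun t => herglotzMeasure (flow X M₀ t)) :
    -- every `M_t` is a Herglotz function, uniquely represented, with measure `μ t`
    (∀ t : ℝ, IsHerglotz (flow X M₀ t) ∧
      (∃! p : ℝ × ℝ × Measure ℝ, IsHerglotzRep (flow X M₀ t) p.1 p.2.1 p.2.2) ∧
      ∃ A B : ℝ, IsHerglotzRep (flow X M₀ t) A B (μ t)) ∧
    -- for finite end points, `avgMeasure` is the measure in the representation of `M_{s₁,s₂}`
    (∀ s₁ s₂ : ℝ, s₁ < s₂ →
      (∀ z : ℂ, 0 < z.im →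
        IntervalIntegrable (fun t => flow X M₀ t z) volume s₁ s₂) ∧
      (∃! p : ℝ × ℝ × Measure ℝ, IsHerglotzRep (intFlow X M₀ s₁ s₂) p.1 p.2.1 p.2.2) ∧
      ∃ B : ℝ, IsHerglotzRep (intFlow X M₀ s₁ s₂) 0 B (avgMeasure X M₀ s₁ s₂)) ∧
    -- the three sets are Borel sets
    (MeasurableSet (setA M₀) ∧ MeasurableSet (setS M₀) ∧ MeasurableSet (setP M₀)) ∧
    -- the averages, for finite or infinite end points
    (∀ t₁ t₂ : EReal, t₁ < t₂ →
      (∀ E : Set ℝ, MeasurableSet E →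
        avgMeasure X M₀ t₁ t₂ E =
          ⨆ (s₁ : ℝ) (s₂ : ℝ) (_ : t₁ ≤ s₁ ∧ s₁ < s₂ ∧ (s₂ : EReal) ≤ t₂),
            avgMeasure X M₀ s₁ s₂ E) ∧
      (∀ z : ℂ, 0 < z.im →
        ∫⁻ t in timeInterval t₁ t₂, ENNReal.ofReal (flow X M₀ t z).im =
          ∫⁻ x : ℝ, ENNReal.ofReal (1 / ((x : ℂ) - z)).im ∂(avgMeasure X M₀ t₁ t₂)) ∧
      avgMeasure X M₀ t₁ t₂ ≪ volume ∧
      (Measurable μ ∧ timeIntegral μ t₁ t₂ ≪ volume) ∧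
      (Measurable (fun t => acPart (μ t)) ∧
        timeIntegral (fun t => acPart (μ t)) t₁ t₂ ≪ volume) ∧
      (Measurable (fun t => scPart (μ t)) ∧
        timeIntegral (fun t => scPart (μ t)) t₁ t₂ ≪ volume) ∧
      (Measurable (fun t => ppPart (μ t)) ∧
        timeIntegral (fun t => ppPart (μ t)) t₁ t₂ ≪ volume) ∧
      ∀ Δ : Set ℝ, Bornology.IsBounded Δ → MeasurableSet Δ →
        (Measurable (fun t => μ t Δ) ∧
          ∫⁻ t in timeInterval t₁ t₂, μ t Δ = avgMeasure X M₀ t₁ t₂ Δ) ∧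
        (Measurable (fun t => acPart (μ t) Δ) ∧
          ∫⁻ t in timeInterval t₁ t₂, acPart (μ t) Δ =
            avgMeasure X M₀ t₁ t₂ (Δ ∩ setA M₀)) ∧
        (Measurable (fun t => scPart (μ t) Δ) ∧
          ∫⁻ t in timeInterval t₁ t₂, scPart (μ t) Δ =
            avgMeasure X M₀ t₁ t₂ (Δ ∩ setS M₀)) ∧
        (Measurable (fun t => ppPart (μ t) Δ) ∧
          ∫⁻ t in timeInterval t₁ t₂, ppPart (μ t) Δ =
            avgMeasure X M₀ t₁ t₂ (Δ ∩ setP M₀))) ∧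
    -- consequences
    (volume (setS M₀) = 0 → volume {t : ℝ | scPart (μ t) univ ≠ 0} = 0) ∧
    (volume (setP M₀) = 0 → volume {t : ℝ | ppPart (μ t) univ ≠ 0} = 0) := by

  obtain rfl : μ = flowMeasure X M₀ := hμ
  have hκ := measurable_flowMeasure hX hM₀
  have hA := measurableSet_setA hM₀.continuousOn
  have hS := measurableSet_setS hM₀.continuousOn
  have hP := measurableSet_setP hM₀.continuousOn
  simp only [fun t => (parts_flowMeasure hX hM₀ t).1, fun t => (parts_flowMeasure hX hM₀ t).2.1,
    fun t => (parts_flowMeasure hX hM₀ t).2.2]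
  refine ⟨fun t => ?_, fun s₁ s₂ hs => ?_, ⟨hA, hS, hP⟩, fun t₁ t₂ _ => ?_,
    volume_restrict_flowMeasure_ne_zero hX hγ hM₀ hS,
    volume_restrict_flowMeasure_ne_zero hX hγ hM₀ hP⟩
  · obtain ⟨A, B, h⟩ := exists_rep_flow hX hM₀ t
    exact ⟨isHerglotz_flow hX hM₀ t, h.existsUnique, A, B, h⟩
  · have h := isHerglotzRep_intFlow hX hγ hM₀ hs.le
    rw [avgMeasure_eq_timeIntegral hX hγ hM₀]
    exact ⟨fun z hz => (continuous_flow hX hM₀ hz).intervalIntegrable _ _, h.existsUnique, _, h⟩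
  · have hac := fun (s : Set ℝ) (hs : MeasurableSet s) =>
      And.intro (measurable_restrict_family hκ hs)
        (timeIntegral_restrict_absolutelyContinuous hX hγ hM₀ (measurable_restrict_family hκ hs)
          (fun _ => Measure.restrict_le_self) t₁ t₂)
    have hac₀ := timeIntegral_restrict_absolutelyContinuous hX hγ hM₀ hκ (fun _ => le_rfl) t₁ t₂
    refine ⟨fun E hE => ?_, fun z hz => ?_, ?_, ⟨hκ, hac₀⟩, hac _ hA, hac _ hS, hac _ hP,
      fun Δ _ hΔ => ⟨⟨(Measure.measurable_coe hΔ).comp hκ, ?_⟩,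
        average_restrict_flowMeasure hX hγ hM₀ hA t₁ t₂ hΔ,
        average_restrict_flowMeasure hX hγ hM₀ hS t₁ t₂ hΔ,
        average_restrict_flowMeasure hX hγ hM₀ hP t₁ t₂ hΔ⟩⟩
    · simp only [avgMeasure_eq_timeIntegral hX hγ hM₀]
      exact timeIntegral_eq_iSup hκ t₁ t₂ hE
    · rw [avgMeasure_eq_timeIntegral hX hγ hM₀]
      exact lintegral_flow_im hX hγ hM₀ t₁ t₂ hz
    · rwa [avgMeasure_eq_timeIntegral hX hγ hM₀]
    · rw [avgMeasure_eq_timeIntegral hX hγ hM₀, timeIntegral_apply hκ _ _ hΔ]
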